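/- Let $\mathbb{T}^d=\mathbb{R}^d/\mathbb{Z}^d$. All maps on $\mathbb{T}^d$ are of class $\mathcal{C}^\infty$. Let $\|f\|_{\mathcal{C}^r}=\max_{|\alpha|\le r}\sup_\theta\|\partial^\alpha f(\theta)\|$, where matrices carry an operator norm, and let $\partial_\omega f(\theta)=\frac{d}{dt}f(\theta+t\omega)|_{t=0}$. Let $\omega\in\mathbb{R}^d$ be Diophantine, i.e. for some $\kappa>0$ and $\tau>d-1$ one has $|\langle k,\omega\rangle|\ge\kappa\,(|k_1|+\dots+|k_d|)^{-\tau}$ for all $k\in\mathbb{Z}^d\setminus\{0\}$. Let $A:\mathbb{T}^d\to\mathcal{M}(n,\mathbb{R})$, and let $X_{\omega,A}$ be the real quasi-periodic cocycle defined by $\frac{d}{dt}X^t_{\omega,A}(\theta)=A(\theta+t\omega)X^t_{\omega,A}(\theta)$, $X^0_{\omega,A}(\theta)=I$. Suppose that $X_{\omega,A}$ is almost reducible to real matrices, i.e. that there are sequences $Z_j:\mathbb{T}^d\to GL(n,\mathbb{C})$, $B_j\in\mathcal{M}(n,\mathbb{R})$ and $F_j:\mathbb{T}^d\to\mathcal{M}(n,\mathbb{C})$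 with $$\partial_\omega Z_j=AZ_j-Z_j(B_j+F_j)\quad\text{for all } j,\qquad \lim_{j\to\infty}\|Z_j^{\pm1}\|_{\mathcal{C}^r}^m\,\|F_j\|_{\mathcal{C}^r}=0\quad\text{for all } r,m\in\mathbb{N}.$$ Then $X_{\omega,A}$ is real almost reducible: there are sequences $W_j:\mathbb{T}^d\to GL(n,\mathbb{R})$, $B_j'\in\mathcal{M}(n,\mathbb{R})$ and $G_j:\mathbb{T}^d\to\mathcal{M}(n,\mathbb{R})$ with $$\partial_\omega W_j=AW_j-W_j(B_j'+G_j)\quad\text{for all } j,\qquad \lim_{j\to\infty}\|W_j^{\pm1}\|_{\mathcal{C}^r}^m\,\|G_j\|_{\mathcal{C}^r}=0\quad\text{for all } r,m\in\mathbb{N}.$$ Moreover, for some $J\in\mathbb{N}$ and some sequence $\lambda_j\in[-1,1]$, one can take $W_j=\Re Z_{J+j}+\lambda_j\,\Im Z_{J+j}$ for all $j$. -/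

import Mathlib

open scoped Matrix Matrix.Norms.Operator

noncomputable section

/-- The canonical projection `ℝ^d → 𝕋^d = ℝ^d / ℤ^d`. -/
def torusProj {d : ℕ} (x : Fin d → ℝ) : UnitAddTorus (Fin d) :=
  fun i => (x i : UnitAddCircle)

/-- A map on `𝕋^d` is of class `C^∞` when its `ℤ^d`-periodic lift to `ℝ^d` is. -/
def TorusSmooth {d : ℕ} {E : Type*} [NormedAddCommGroup E] [NormedSpace ℝ E]
    (f : UnitAddTorus (Fin d) → E) : Prop :=
  ContDiff ℝ ((⊤ : ℕ∞) : WithTop ℕ∞) (fun x : Fin d → ℝ => f (torusProj x))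

/-- The norm `‖f‖_{C^r} = max_{|α| ≤ r} sup_θ ‖∂^α f(θ)‖`. The partial derivatives of order `k` are
written `∂_{w 0} ⋯ ∂_{w (k-1)}` with `w : Fin k → Fin d`; for smooth `f` these are exactly the
`∂^α f` with `|α| = k`. Matrices carry the operator norm `Matrix.Norms.Operator`. -/
def crNorm {d : ℕ} {E : Type*} [NormedAddCommGroup E] [NormedSpace ℝ E]
    (r : ℕ) (f : UnitAddTorus (Fin d) → E) : ℝ :=
  ⨆ w : (k : Fin (r + 1)) × (Fin k → Fin d), ⨆ x : Fin d → ℝ,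
    ‖iteratedFDeriv ℝ w.1 (fun y : Fin d → ℝ => f (torusProj y)) x
      (fun i => Pi.single (w.2 i) (1 : ℝ))‖

/-- `∂_ω f (θ) = d/dt f(θ + t ω)` at `t = 0`. -/
def omegaDeriv {d : ℕ} {E : Type*} [NormedAddCommGroup E] [NormedSpace ℝ E]
    (ω : Fin d → ℝ) (f : UnitAddTorus (Fin d) → E) (θ : UnitAddTorus (Fin d)) : E :=
  deriv (fun t : ℝ => f (θ + torusProj (t • ω))) 0

/-- The Diophantine condition `ω ∈ DC(κ, τ)`, with `κ > 0` and `τ > d - 1`. -/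
def IsDiophantine {d : ℕ} (κ τ : ℝ) (ω : Fin d → ℝ) : Prop :=
  0 < κ ∧ (d : ℝ) - 1 < τ ∧
    ∀ k : Fin d → ℤ, k ≠ 0 →
      κ / (∑ i, |(k i : ℝ)|) ^ τ ≤ |∑ i, (k i : ℝ) * ω i|

/-- Sequences `Z_j : 𝕋^d → GL(n, 𝕜)`, `B_j ∈ gl(n, 𝕜)`, `F_j : 𝕋^d → gl(n, 𝕜)` of smooth maps
realizing the almost reducibility, over `𝕜`, of the quasi-periodic cocycle with frequency `ω`
generated by `A`. -/
structure IsAlmostReduction {d n : ℕ} {𝕜 : Type*} [RCLike 𝕜] (ω : Fin d → ℝ)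
    (A : UnitAddTorus (Fin d) → Matrix (Fin n) (Fin n) 𝕜)
    (Z : ℕ → UnitAddTorus (Fin d) → GL (Fin n) 𝕜)
    (B : ℕ → Matrix (Fin n) (Fin n) 𝕜)
    (F : ℕ → UnitAddTorus (Fin d) → Matrix (Fin n) (Fin n) 𝕜) : Prop where
  smooth_conj : ∀ j, TorusSmooth (fun θ => (Z j θ : Matrix (Fin n) (Fin n) 𝕜))
  smooth_rem : ∀ j, TorusSmooth (F j)
  conj_eq : ∀ j θ, omegaDeriv ω (fun η => (Z j η : Matrix (Fin n) (Fin n) 𝕜)) θ =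
    A θ * (Z j θ : Matrix (Fin n) (Fin n) 𝕜) -
      (Z j θ : Matrix (Fin n) (Fin n) 𝕜) * (B j + F j θ)
  tendsto_pos : ∀ r m : ℕ, Filter.Tendsto
    (fun j => crNorm r (fun θ => (Z j θ : Matrix (Fin n) (Fin n) 𝕜)) ^ m * crNorm r (F j))
    Filter.atTop (nhds 0)
  tendsto_neg : ∀ r m : ℕ, Filter.Tendsto
    (fun j => crNorm r (fun θ => (((Z j θ)⁻¹ : GL (Fin n) 𝕜) : Matrix (Fin n) (Fin n) 𝕜)) ^ m *
      crNorm r (F j))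
    Filter.atTop (nhds 0)

/-- The real cocycle generated by `A` is real almost reducible: it is almost reducible through
real conjugations and real constant matrices (the remainders are then real too). -/
def RealAlmostReducible {d n : ℕ} (ω : Fin d → ℝ)
    (A : UnitAddTorus (Fin d) → Matrix (Fin n) (Fin n) ℝ) : Prop :=
  ∃ (Z : ℕ → UnitAddTorus (Fin d) → GL (Fin n) ℝ) (B : ℕ → Matrix (Fin n) (Fin n) ℝ)
    (F : ℕ → UnitAddTorus (Fin d) → Matrix (Fin n) (Fin n) ℝ),
    IsAlmostReduction ω A Z B F

end

/-! ### Smooth maps on the torus, their `C^r` norms and directional derivatives. -/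

section Torus

variable {d : ℕ} {E : Type*} [NormedAddCommGroup E] [NormedSpace ℝ E]

/-! Write `W_t = Re Z_j + t Im Z_j` and `Q_t = Z_j⁻¹ W_t`. Since `A` and `B_j` are real, `W_t`
solves the same conjugation equation as `Z_j`, with the same `B_j` and with the error `H = Re (Z_j
F_j) + t Im (Z_j F_j)`. What has to be shown is that for a good choice of `t` the matrix `W_t` is
invertible, with an inverse bounded by a power of the norms of `Z_j` and `Z_j⁻¹`; then `G_j = W_t⁻¹
H` is still negligible.

The quantity to control is `det Q_t` (`relDet`). At a fixed point of the torus it is a polynomial in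
`t` of degree at most `n` with value `1` at `t = i`, so by Lagrange interpolation it is bounded
below, by a constant depending on `n` only, at one of `n + 1` fixed real nodes
(`exists_le_norm_relDet`). To reach all `θ`, differentiate along `ω`: `A` cancels and `B_j` enters
only through a commutator, which the trace in Jacobi's formula kills
(`Matrix.hasDerivAt_det_inv_mul`). Hence `∂_ω det Q_t` is negligible however large `B_j` is, and the
Diophantine condition turns this into a small oscillation (`IsDiophantine.exists_norm_sub_le`).
Finally `W_t⁻¹ = (det Q_t)⁻¹ adj(Q_t) Z_j⁻¹` gives the bound on the inverse. -/

theorem torusProj_surjective : Function.Surjective (torusProj (d := d)) := by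
  intro θ
  choose x hx using fun i => QuotientAddGroup.mk_surjective (θ i)
  exact ⟨x, funext hx⟩

theorem torusProj_add (x y : Fin d → ℝ) : torusProj (x + y) = torusProj x + torusProj y := by
  funext i
  simp [torusProj]

theorem torusProj_zero : torusProj (0 : Fin d → ℝ) = 0 := by
  funext i
  simp [torusProj]

theorem torusProj_add_intCast (x : Fin d → ℝ) (k : Fin d → ℤ) :
    torusProj (x + fun i => (k i : ℝ)) = torusProj x := by
  funext i
  simp [torusProj]

theorem isQuotientMap_torusProj : Topology.IsQuotientMap (torusProj (d := d)) :=
  (IsOpenQuotientMap.piMap fun _ : Fin d =>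
    (QuotientAddGroup.isOpenQuotientMap_mk :
      IsOpenQuotientMap (fun x : ℝ => (x : UnitAddCircle)))).isQuotientMap

theorem TorusSmooth.continuous {f : UnitAddTorus (Fin d) → E} (hf : TorusSmooth f) :
    Continuous f :=
  isQuotientMap_torusProj.continuous_iff.2 (ContDiff.continuous hf)

theorem TorusSmooth.exists_norm_iteratedFDeriv_le {f : UnitAddTorus (Fin d) → E}
    (hf : TorusSmooth f) (k : ℕ) :
    ∃ C, ∀ x, ‖iteratedFDeriv ℝ k (fun y : Fin d → ℝ => f (torusProj y)) x‖ ≤ C := by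
  have hc : Continuous (iteratedFDeriv ℝ k (fun y : Fin d → ℝ => f (torusProj y))) :=
    ContDiff.continuous_iteratedFDeriv (n := ((⊤ : ℕ∞) : WithTop ℕ∞))
      (by exact_mod_cast le_top) hf
  obtain ⟨C, hC⟩ := (isCompact_Icc (a := (0 : Fin d → ℝ)) (b := 1)).exists_bound_of_continuousOn
    hc.continuousOn
  refine ⟨C, fun x => ?_⟩
  -- Translating by the integer parts of the coordinates moves any point into the compact unit cube.
  have hper := iteratedFDeriv_comp_add_right (𝕜 := ℝ)
    (f := fun y : Fin d → ℝ => f (torusProj y)) k (fun i => ((-⌊x i⌋ : ℤ) : ℝ)) x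
  simp only [torusProj_add_intCast] at hper
  rw [hper]
  refine hC _ ⟨fun i => ?_, fun i => ?_⟩
  · have := Int.floor_le (x i)
    simp only [Pi.add_apply, Pi.zero_apply, Int.cast_neg]
    linarith
  · have := (Int.lt_floor_add_one (x i)).le
    simp only [Pi.add_apply, Pi.one_apply, Int.cast_neg]
    linarith

theorem norm_pi_single_le_one (i : Fin d) : ‖(Pi.single i (1 : ℝ) : Fin d → ℝ)‖ ≤ 1 := by
  simp [Pi.norm_single]

theorem norm_iteratedFDeriv_single_le_crNorm {f : UnitAddTorus (Fin d) → E} (hf : TorusSmooth f)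
    {r k : ℕ} (hk : k ≤ r) (w : Fin k → Fin d) (x : Fin d → ℝ) :
    ‖iteratedFDeriv ℝ k (fun y : Fin d → ℝ => f (torusProj y)) x
      (fun i => Pi.single (w i) (1 : ℝ))‖ ≤ crNorm r f := by
  let g : ((k : Fin (r + 1)) × (Fin k → Fin d)) → (Fin d → ℝ) → ℝ := fun w x =>
    ‖iteratedFDeriv ℝ w.1 (fun y : Fin d → ℝ => f (torusProj y)) x
      (fun i => Pi.single (w.2 i) (1 : ℝ))‖
  -- Boundedness is essential: the supremum of an unbounded real family is `0` by convention.
  have hg : ∀ w, BddAbove (Set.range (g w)) := fun w => by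
    obtain ⟨C, hC⟩ := hf.exists_norm_iteratedFDeriv_le w.1
    refine ⟨C, ?_⟩
    rintro _ ⟨x, rfl⟩
    refine (ContinuousMultilinearMap.le_opNorm _ _).trans ?_
    refine (mul_le_of_le_one_right (norm_nonneg _) ?_).trans (hC x)
    exact Finset.prod_le_one (fun _ _ => norm_nonneg _) fun i _ => norm_pi_single_le_one _
  let w' : (k : Fin (r + 1)) × (Fin k → Fin d) := ⟨⟨k, Nat.lt_succ_of_le hk⟩, w⟩
  exact (le_ciSup (hg w') x).trans
    (le_ciSup (f := fun w => ⨆ x, g w x) (Set.finite_range _).bddAbove w')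

theorem crNorm_nonneg (r : ℕ) (f : UnitAddTorus (Fin d) → E) : 0 ≤ crNorm r f :=
  Real.iSup_nonneg fun _ => Real.iSup_nonneg fun _ => norm_nonneg _

theorem crNorm_le {f : UnitAddTorus (Fin d) → E} {r : ℕ} {C : ℝ}
    (h : ∀ k ≤ r, ∀ x, ‖iteratedFDeriv ℝ k (fun y : Fin d → ℝ => f (torusProj y)) x‖ ≤ C) :
    crNorm r f ≤ C := by
  have : Nonempty ((k : Fin (r + 1)) × (Fin k → Fin d)) := ⟨⟨0, Fin.elim0⟩⟩
  refine ciSup_le fun w => ciSup_le fun x => ?_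
  refine (ContinuousMultilinearMap.le_opNorm _ _).trans ?_
  refine (mul_le_of_le_one_right (norm_nonneg _) ?_).trans
    (h w.1 (Nat.le_of_lt_succ w.1.2) x)
  exact Finset.prod_le_one (fun _ _ => norm_nonneg _) fun i _ => norm_pi_single_le_one _

theorem ContinuousMultilinearMap.norm_le_of_apply_single_le {k : ℕ}
    (T : ContinuousMultilinearMap ℝ (fun _ : Fin k => Fin d → ℝ) E) {C : ℝ} (hC : 0 ≤ C)
    (h : ∀ w : Fin k → Fin d, ‖T (fun i => Pi.single (w i) (1 : ℝ))‖ ≤ C) :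
    ‖T‖ ≤ (d : ℝ) ^ k * C := by
  refine ContinuousMultilinearMap.opNorm_le_bound (by positivity) fun v => ?_
  have hv : v = fun i => ∑ a : Fin d, v i a • (Pi.single a (1 : ℝ) : Fin d → ℝ) := by
    funext i
    exact pi_eq_sum_univ' (v i)
  calc ‖T v‖ = ‖∑ w : Fin k → Fin d, (∏ i, v i (w i)) • T fun i => Pi.single (w i) (1 : ℝ)‖ := by
        conv_lhs => rw [hv]
        rw [T.map_sum]
        simp_rw [T.map_smul_univ]
    _ ≤ ∑ w : Fin k → Fin d, (∏ i, ‖v i‖) * C := by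
        refine norm_sum_le_of_le _ fun w _ => ?_
        rw [norm_smul, norm_prod]
        gcongr with i
        · exact norm_le_pi_norm (v i) (w i)
        · exact h w
    _ = (d : ℝ) ^ k * C * ∏ i, ‖v i‖ := by
        simp
        ring

/-- The base `d + 1` rather than `d` keeps the constant monotone in the exponent, including when `d
= 0`. -/
theorem norm_iteratedFDeriv_le_crNorm {f : UnitAddTorus (Fin d) → E} (hf : TorusSmooth f)
    {r k : ℕ} (hk : k ≤ r) (x : Fin d → ℝ) :
    ‖iteratedFDeriv ℝ k (fun y : Fin d → ℝ => f (torusProj y)) x‖ ≤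
      ((d : ℝ) + 1) ^ r * crNorm r f := by
  refine (ContinuousMultilinearMap.norm_le_of_apply_single_le _ (crNorm_nonneg r f) fun w =>
    norm_iteratedFDeriv_single_le_crNorm hf hk w x).trans ?_
  gcongr ?_ * _
  · exact crNorm_nonneg r f
  calc (d : ℝ) ^ k ≤ ((d : ℝ) + 1) ^ k := by gcongr; linarith
    _ ≤ ((d : ℝ) + 1) ^ r := by gcongr; simp

theorem TorusSmooth.hasFDerivAt {f : UnitAddTorus (Fin d) → E} (hf : TorusSmooth f)
    (x : Fin d → ℝ) : HasFDerivAt (fun y => f (torusProj y))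
      (fderiv ℝ (fun y => f (torusProj y)) x) x :=
  ((ContDiff.differentiable hf (by simp)) x).hasFDerivAt

theorem TorusSmooth.hasDerivAt_line {f : UnitAddTorus (Fin d) → E} (hf : TorusSmooth f)
    (v x : Fin d → ℝ) (t : ℝ) :
    HasDerivAt (fun t : ℝ => f (torusProj x + torusProj (t • v)))
      (fderiv ℝ (fun y => f (torusProj y)) (x + t • v) v) t := by
  simp_rw [← torusProj_add]
  have hl : HasDerivAt (fun t : ℝ => x + t • v) v t := by
    simpa using ((hasDerivAt_id t).smul_const v).const_add x
  exact (hf.hasFDerivAt (x + t • v)).comp_hasDerivAt t hl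

theorem TorusSmooth.omegaDeriv_torusProj {f : UnitAddTorus (Fin d) → E} (hf : TorusSmooth f)
    (v x : Fin d → ℝ) :
    omegaDeriv v f (torusProj x) = fderiv ℝ (fun y => f (torusProj y)) x v := by
  simpa [omegaDeriv] using (hf.hasDerivAt_line v x 0).deriv

theorem TorusSmooth.hasDerivAt_line_omegaDeriv {f : UnitAddTorus (Fin d) → E} (hf : TorusSmooth f)
    (v : Fin d → ℝ) (θ : UnitAddTorus (Fin d)) (t : ℝ) :
    HasDerivAt (fun t : ℝ => f (θ + torusProj (t • v)))
      (omegaDeriv v f (θ + torusProj (t • v))) t := by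
  obtain ⟨x, rfl⟩ := torusProj_surjective θ
  rw [← torusProj_add, hf.omegaDeriv_torusProj]
  exact hf.hasDerivAt_line v x t

theorem TorusSmooth.omegaDeriv {f : UnitAddTorus (Fin d) → E} (hf : TorusSmooth f)
    (v : Fin d → ℝ) : TorusSmooth (omegaDeriv v f) := by
  unfold TorusSmooth
  simp_rw [hf.omegaDeriv_torusProj]
  exact (ContDiff.fderiv_right hf (by simp)).clm_apply contDiff_const

theorem TorusSmooth.iterate_omegaDeriv {f : UnitAddTorus (Fin d) → E} (hf : TorusSmooth f)
    (v : Fin d → ℝ) (k : ℕ) : TorusSmooth ((_root_.omegaDeriv v)^[k] f) := by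
  induction k with
  | zero => exact hf
  | succ k ih =>
    rw [Function.iterate_succ_apply']
    exact ih.omegaDeriv v

theorem TorusSmooth.iterate_omegaDeriv_torusProj {f : UnitAddTorus (Fin d) → E}
    (hf : TorusSmooth f) (v : Fin d → ℝ) (k : ℕ) (x : Fin d → ℝ) :
    (_root_.omegaDeriv v)^[k] f (torusProj x) =
      iteratedFDeriv ℝ k (fun y => f (torusProj y)) x (fun _ => v) := by
  induction k generalizing x with
  | zero => simp
  | succ k ih =>
    rw [Function.iterate_succ_apply', (hf.iterate_omegaDeriv v k).omegaDeriv_torusProj,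
      iteratedFDeriv_succ_apply_left]
    simp_rw [ih]
    have hd : DifferentiableAt ℝ (iteratedFDeriv ℝ k (fun y => f (torusProj y))) x :=
      (ContDiff.differentiable_iteratedFDeriv (n := ((⊤ : ℕ∞) : WithTop ℕ∞))
        (by exact_mod_cast ENat.natCast_lt_top k) hf) x
    exact congrArg (fun L : (Fin d → ℝ) →L[ℝ] E => L v)
      ((ContinuousMultilinearMap.apply ℝ (fun _ : Fin k => Fin d → ℝ) E
        (fun _ => v)).hasFDerivAt.comp x hd.hasFDerivAt).fderiv

end Torus

/-! ### Fourier coefficients and the small divisor estimate. -/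

section Fourier

open MeasureTheory UnitAddTorus

attribute [local instance] instMeasureSpaceUnitAddCircle

variable {d : ℕ}

theorem isAddHaarMeasure_volume_unitAddCircle :
    Measure.IsAddHaarMeasure (volume : Measure UnitAddCircle) :=
  inferInstanceAs (Measure.IsAddHaarMeasure AddCircle.haarAddCircle)

theorem isProbabilityMeasure_volume_unitAddCircle :
    IsProbabilityMeasure (volume : Measure UnitAddCircle) :=
  inferInstanceAs (IsProbabilityMeasure AddCircle.haarAddCircle)

attribute [local instance] isAddHaarMeasure_volume_unitAddCircle
  isProbabilityMeasure_volume_unitAddCircle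

theorem mFourier_add_apply (k : Fin d → ℤ) (θ φ : UnitAddTorus (Fin d)) :
    mFourier k (θ + φ) = mFourier k θ * mFourier k φ := by
  simp only [mFourier, ContinuousMap.coe_mk, ← Finset.prod_mul_distrib]
  refine Finset.prod_congr rfl fun i _ => ?_
  simp only [fourier_apply, Pi.add_apply, smul_add, AddCircle.toCircle_add, Circle.coe_mul]

theorem mFourier_torusProj (k : Fin d → ℤ) (x : Fin d → ℝ) :
    mFourier k (torusProj x) = Complex.exp (2 * Real.pi * Complex.I * ∑ i, (k i : ℝ) * x i) := by
  simp only [mFourier, ContinuousMap.coe_mk, torusProj, fourier_coe_apply, ← Complex.exp_sum]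
  congr 1
  push_cast
  rw [Finset.mul_sum]
  refine Finset.sum_congr rfl fun i _ => ?_
  ring

theorem norm_mFourier_apply (k : Fin d → ℤ) (θ : UnitAddTorus (Fin d)) : ‖mFourier k θ‖ = 1 := by
  simp only [mFourier, fourier_apply, ContinuousMap.coe_mk, norm_prod, Circle.norm_coe,
    Finset.prod_const_one]

theorem mFourierCoeff_comp_add_right (g : UnitAddTorus (Fin d) → ℂ) (k : Fin d → ℤ)
    (φ : UnitAddTorus (Fin d)) :
    mFourierCoeff (fun θ => g (θ + φ)) k = mFourier k φ * mFourierCoeff g k := by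
  unfold mFourierCoeff
  rw [← integral_add_right_eq_self (fun θ => mFourier (-k) θ • g θ) φ, ← integral_const_mul]
  refine integral_congr_ae (Filter.Eventually.of_forall fun θ => ?_)
  have h : mFourier k φ * mFourier (-k) φ = 1 := by
    rw [← ContinuousMap.mul_apply, mul_comm]
    have := mFourier_add (n := k) (m := -k) (x := φ)
    rw [neg_add_cancel, mFourier_zero] at this
    exact this.symm
  simp only [mFourier_add_apply, smul_eq_mul]
  linear_combination -(mFourier (-k) θ * g (θ + φ)) * h

theorem norm_mFourierCoeff_le {g : UnitAddTorus (Fin d) → ℂ} {C : ℝ} (h : ∀ θ, ‖g θ‖ ≤ C)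
    (k : Fin d → ℤ) : ‖mFourierCoeff g k‖ ≤ C := by
  refine (norm_integral_le_of_norm_le_const (C := C) (Filter.Eventually.of_forall fun θ => ?_)).trans
    (by simp)
  rw [norm_smul, norm_mFourier_apply, one_mul]
  exact h θ

theorem TorusSmooth.exists_norm_le {g : UnitAddTorus (Fin d) → ℂ} (hg : TorusSmooth g) :
    ∃ C, ∀ θ, ‖g θ‖ ≤ C := by
  obtain ⟨C, hC⟩ := hg.exists_norm_iteratedFDeriv_le 0
  refine ⟨C, fun θ => ?_⟩
  obtain ⟨x, rfl⟩ := torusProj_surjective θ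
  simpa using hC x

/-- The coefficient of the translate `g(· + t v)` is differentiated at `t = 0` in two ways: under
the integral, and through the character factor produced by invariance of the measure. Uniqueness of
derivatives replaces an integration by parts. -/
theorem TorusSmooth.mFourierCoeff_omegaDeriv {g : UnitAddTorus (Fin d) → ℂ} (hg : TorusSmooth g)
    (v : Fin d → ℝ) (k : Fin d → ℤ) :
    mFourierCoeff (_root_.omegaDeriv v g) k =
      2 * Real.pi * Complex.I * (∑ i, (k i : ℝ) * v i : ℝ) * mFourierCoeff g k := by
  have hdg := hg.omegaDeriv v
  obtain ⟨C, hC⟩ := hdg.exists_norm_le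
  have hcont : ∀ φ : UnitAddTorus (Fin d), ∀ f : UnitAddTorus (Fin d) → ℂ, TorusSmooth f →
      Continuous fun θ => mFourier (-k) θ • f (θ + φ) := fun φ f hf =>
    (mFourier (-k)).continuous.smul (hf.continuous.comp (continuous_id.add continuous_const))
  have h1 : HasDerivAt (fun t : ℝ => mFourierCoeff (fun θ => g (θ + torusProj (t • v))) k)
      (mFourierCoeff (_root_.omegaDeriv v g) k) 0 := by
    have := (hasDerivAt_integral_of_dominated_loc_of_deriv_le (μ := (volume : Measure
        (UnitAddTorus (Fin d)))) (bound := fun _ => C) (s := Set.univ) (x₀ := (0 : ℝ))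
      (F := fun t θ => mFourier (-k) θ • g (θ + torusProj (t • v)))
      (F' := fun t θ => mFourier (-k) θ • _root_.omegaDeriv v g (θ + torusProj (t • v)))
      Filter.univ_mem (Filter.Eventually.of_forall fun t => (hcont _ g hg).aestronglyMeasurable)
      ((hcont _ g hg).integrable_of_hasCompactSupport (HasCompactSupport.of_compactSpace _))
      (hcont _ _ hdg).aestronglyMeasurable
      (Filter.Eventually.of_forall fun θ t _ => by
        rw [norm_smul, norm_mFourier_apply, one_mul]
        exact hC _)
      (integrable_const C)
      (Filter.Eventually.of_forall fun θ t _ =>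
        (hg.hasDerivAt_line_omegaDeriv v θ t).const_mul _)).2
    simpa [mFourierCoeff, torusProj_zero] using this
  have h2 : HasDerivAt (fun t : ℝ => mFourierCoeff (fun θ => g (θ + torusProj (t • v))) k)
      (2 * Real.pi * Complex.I * (∑ i, (k i : ℝ) * v i : ℝ) * mFourierCoeff g k) 0 := by
    have he : (fun t : ℝ => mFourierCoeff (fun θ => g (θ + torusProj (t • v))) k) = fun t : ℝ =>
        Complex.exp ((t : ℂ) * (2 * Real.pi * Complex.I * (∑ i, (k i : ℝ) * v i : ℝ))) *
          mFourierCoeff g k := by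
      funext t
      rw [mFourierCoeff_comp_add_right, mFourier_torusProj]
      congr 2
      simp only [Pi.smul_apply, smul_eq_mul, mul_left_comm _ t, ← Finset.mul_sum]
      push_cast
      ring
    rw [he]
    have := ((Complex.ofRealCLM.hasDerivAt (x := (0 : ℝ))).mul_const
      (2 * Real.pi * Complex.I * (∑ i, (k i : ℝ) * v i : ℝ))).cexp.mul_const (mFourierCoeff g k)
    simpa using this
  exact h1.unique h2

theorem TorusSmooth.mFourierCoeff_iterate_omegaDeriv {g : UnitAddTorus (Fin d) → ℂ}
    (hg : TorusSmooth g) (v : Fin d → ℝ) (k : Fin d → ℤ) (r : ℕ) :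
    mFourierCoeff ((_root_.omegaDeriv v)^[r] g) k =
      (2 * Real.pi * Complex.I * (∑ i, (k i : ℝ) * v i : ℝ)) ^ r * mFourierCoeff g k := by
  induction r with
  | zero => simp
  | succ r ih =>
    rw [Function.iterate_succ_apply', (hg.iterate_omegaDeriv v r).mFourierCoeff_omegaDeriv, ih]
    ring

theorem TorusSmooth.norm_pow_mul_norm_mFourierCoeff_le {g : UnitAddTorus (Fin d) → ℂ}
    (hg : TorusSmooth g) (k : Fin d → ℤ) (i : Fin d) (r : ℕ) :
    |(k i : ℝ)| ^ r * ‖mFourierCoeff g k‖ ≤ crNorm r g := by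
  have h := norm_mFourierCoeff_le (g := (_root_.omegaDeriv (Pi.single i (1 : ℝ)))^[r] g)
    (C := crNorm r g) (fun θ => by
      obtain ⟨x, rfl⟩ := torusProj_surjective θ
      rw [hg.iterate_omegaDeriv_torusProj]
      exact norm_iteratedFDeriv_single_le_crNorm hg le_rfl (fun _ => i) x) k
  rw [hg.mFourierCoeff_iterate_omegaDeriv, norm_mul, norm_pow] at h
  refine le_trans ?_ h
  gcongr
  have hs : ∑ j, (k j : ℝ) * (Pi.single i (1 : ℝ) : Fin d → ℝ) j = k i := by
    simp [Pi.single_apply]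
  rw [hs]
  simp only [norm_mul, Complex.norm_I, Complex.norm_real, Real.norm_eq_abs, mul_one,
    abs_of_pos Real.pi_pos, Complex.norm_ofNat]
  have := Real.pi_gt_three
  nlinarith [abs_nonneg (k i : ℝ)]

theorem summable_int_pi_norm_rpow {s : ℝ} (hs : s < -(d : ℝ)) :
    Summable fun k : Fin d → ℤ => (‖k‖ : ℝ) ^ s := by
  let L := Submodule.span ℤ (Set.range (Pi.basisFun ℝ (Fin d)))
  have hr : Module.finrank ℤ L = d := by
    rw [ZLattice.rank ℝ L]
    simp
  let f : (Fin d → ℤ) → L := fun k => ⟨fun i => (k i : ℝ), by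
    rw [Module.Basis.mem_span_iff_repr_mem]
    intro i
    exact ⟨k i, by simp⟩⟩
  have hf : Function.Injective f := fun k l h => by
    funext i
    have hi : (k i : ℝ) = l i := congrFun (congrArg Subtype.val h) i
    exact_mod_cast hi
  have := (ZLattice.summable_norm_rpow L s (by rw [hr]; exact hs)).comp_injective hf
  exact this

/-- Dividing by `2πi⟨k, ω⟩` costs `‖k‖ ^ τ`, while `r` derivatives in the direction of the largest
coordinate of `k` gain `‖k‖ ^ (-r)`. The factor `d ^ τ` compares the `ℓ¹` norm with the sup norm. -/
theorem IsDiophantine.norm_mFourierCoeff_le {κ τ : ℝ} {ω : Fin d → ℝ} (hω : IsDiophantine κ τ ω)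
    {g : UnitAddTorus (Fin d) → ℂ} (hg : TorusSmooth g) (r : ℕ) {k : Fin d → ℤ} (hk : k ≠ 0) :
    ‖mFourierCoeff g k‖ ≤
      (d : ℝ) ^ τ / κ * crNorm r (omegaDeriv ω g) * ‖k‖ ^ (τ - r) := by
  obtain ⟨hκ, hτ, hdio⟩ := hω
  obtain ⟨i0, hi0⟩ := Function.ne_iff.1 hk
  -- A nonzero `k` forces `d ≥ 1`, hence `τ > 0`, which makes `x ↦ x ^ τ` monotone.
  have hd : 1 ≤ d := by have := i0.2; omega
  have hd' : (1 : ℝ) ≤ d := by exact_mod_cast hd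
  have hτ0 : 0 < τ := by linarith
  have hkpos : 0 < ‖k‖ := norm_pos_iff.2 hk
  have : Nonempty (Fin d) := ⟨i0⟩
  obtain ⟨i, hi⟩ : ∃ i, ‖k‖ = |(k i : ℝ)| := by
    obtain ⟨i, hi⟩ := Finite.exists_max fun i => ‖k i‖
    exact ⟨i, by
      rw [← Int.norm_eq_abs]
      exact le_antisymm ((pi_norm_le_iff_of_nonneg (norm_nonneg _)).2 hi) (norm_le_pi_norm k i)⟩
  have hS1 : ∑ i, |(k i : ℝ)| ≤ d * ‖k‖ := by
    calc ∑ i, |(k i : ℝ)| ≤ ∑ _i : Fin d, ‖k‖ := Finset.sum_le_sum fun i _ => by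
          rw [← Int.norm_eq_abs]
          exact norm_le_pi_norm k i
      _ = d * ‖k‖ := by simp
  have hS0 : 0 < ∑ i, |(k i : ℝ)| :=
    hkpos.trans_le (hi ▸ Finset.single_le_sum (f := fun i => |(k i : ℝ)|)
      (fun _ _ => abs_nonneg _) (Finset.mem_univ i))
  have h1 := (hg.omegaDeriv ω).norm_pow_mul_norm_mFourierCoeff_le k i r
  rw [← hi, hg.mFourierCoeff_omegaDeriv, norm_mul] at h1
  have h2 : κ / ((d : ℝ) ^ τ * ‖k‖ ^ τ) ≤
      ‖2 * (Real.pi : ℂ) * Complex.I * (∑ i, (k i : ℝ) * ω i : ℝ)‖ := by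
    rw [← Real.mul_rpow (by positivity) hkpos.le]
    calc κ / ((d : ℝ) * ‖k‖) ^ τ ≤ κ / (∑ i, |(k i : ℝ)|) ^ τ := by gcongr
      _ ≤ |∑ i, (k i : ℝ) * ω i| := hdio k hk
      _ ≤ _ := by
        simp only [norm_mul, Complex.norm_I, Complex.norm_real, Real.norm_eq_abs, mul_one,
          abs_of_pos Real.pi_pos, Complex.norm_ofNat]
        have := Real.pi_gt_three
        nlinarith [abs_nonneg (∑ i, (k i : ℝ) * ω i)]
  have h3 : ‖k‖ ^ r * (κ / ((d : ℝ) ^ τ * ‖k‖ ^ τ) * ‖mFourierCoeff g k‖) ≤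
      crNorm r (omegaDeriv ω g) := by
    refine le_trans ?_ h1
    gcongr
  have hdp : (0 : ℝ) < (d : ℝ) ^ τ := by positivity
  have hkp : (0 : ℝ) < ‖k‖ ^ τ := by positivity
  rw [Real.rpow_sub hkpos, Real.rpow_natCast]
  calc ‖mFourierCoeff g k‖ = (d : ℝ) ^ τ / κ *
        (‖k‖ ^ r * (κ / ((d : ℝ) ^ τ * ‖k‖ ^ τ) * ‖mFourierCoeff g k‖)) *
          (‖k‖ ^ τ / ‖k‖ ^ r) := by field_simp
    _ ≤ _ := by gcongr

theorem IsDiophantine.exists_norm_sub_le {κ τ : ℝ} {ω : Fin d → ℝ} (hω : IsDiophantine κ τ ω) :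
    ∃ (r : ℕ) (C : ℝ), ∀ g : UnitAddTorus (Fin d) → ℂ, TorusSmooth g → ∀ θ φ,
      ‖g θ - g φ‖ ≤ C * crNorm r (omegaDeriv ω g) := by
  -- With `τ - r < -d` the bounds on the coefficients are summable over `ℤ^d`.
  obtain ⟨r, hr⟩ := exists_nat_gt (τ + d)
  have hsum : Summable fun k : Fin d → ℤ => (‖k‖ : ℝ) ^ (τ - r) :=
    summable_int_pi_norm_rpow (by linarith)
  refine ⟨r, (∑' k : Fin d → ℤ, (‖k‖ : ℝ) ^ (τ - r)) * (2 * ((d : ℝ) ^ τ / κ)),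
    fun g hg θ φ => ?_⟩
  set D := (d : ℝ) ^ τ / κ * crNorm r (omegaDeriv ω g) with hD
  have hD0 : 0 ≤ D := mul_nonneg (div_nonneg (Real.rpow_nonneg (by positivity) _) hω.1.le)
    (crNorm_nonneg _ _)
  have hs : Summable (mFourierCoeff (ContinuousMap.mk g hg.continuous)) := by
    refine Summable.of_norm_bounded_eventually (hsum.mul_left D) ?_
    filter_upwards [(Set.finite_singleton (0 : Fin d → ℤ)).compl_mem_cofinite] with k hk
    exact hω.norm_mFourierCoeff_le hg r hk
  have h := (hasSum_mFourier_series_apply_of_summable hs θ).sub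
    (hasSum_mFourier_series_apply_of_summable hs φ)
  have hb := h.norm_le_of_bounded (hsum.hasSum.mul_right (2 * D)) fun k => by
    rw [← smul_sub]
    -- The zero mode, which `∂_ω g` does not control, drops out of the difference.
    by_cases hk : k = 0
    · subst hk
      simp only [mFourier_zero, ContinuousMap.one_apply, sub_self, smul_zero, norm_zero]
      positivity
    · rw [norm_smul]
      have h1 := hω.norm_mFourierCoeff_le hg r hk
      have h2 : ‖mFourier k θ - mFourier k φ‖ ≤ 2 := by
        refine (norm_sub_le _ _).trans ?_
        rw [norm_mFourier_apply, norm_mFourier_apply]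
        norm_num
      calc _ ≤ D * ‖k‖ ^ (τ - r) * 2 := by
            gcongr
            exact h1
        _ = _ := by ring
  refine hb.trans_eq ?_
  rw [hD]
  ring

end Fourier

/-! ### Calculus of tame and negligible sequences. -/

section Tame

open Filter Topology

variable {X V V₁ V₂ R : Type*} [NormedAddCommGroup X] [NormedSpace ℝ X]
  [NormedAddCommGroup V] [NormedSpace ℝ V] [NormedAddCommGroup V₁] [NormedSpace ℝ V₁]
  [NormedAddCommGroup V₂] [NormedSpace ℝ V₂] [NormedRing R] [NormedAlgebra ℝ R]

/-- A sequence of smooth maps whose derivatives of order at most `r` are bounded by a fixed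
polynomial in the gauge `M`. -/
def Tame (M : ℕ → ℝ) (r : ℕ) (f : ℕ → X → V) : Prop :=
  (∀ j, ContDiff ℝ ((⊤ : ℕ∞) : WithTop ℕ∞) (f j)) ∧
    ∃ (C : ℝ) (m : ℕ), 0 ≤ C ∧ ∀ j, ∀ k ≤ r, ∀ x, ‖iteratedFDeriv ℝ k (f j) x‖ ≤ C * M j ^ m

/-- A sequence of smooth maps whose derivatives of order at most `r` tend to zero uniformly and
faster than every power of `1 / M`. -/
def Negligible (M : ℕ → ℝ) (r : ℕ) (f : ℕ → X → V) : Prop :=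
  (∀ j, ContDiff ℝ ((⊤ : ℕ∞) : WithTop ℕ∞) (f j)) ∧
    ∃ b : ℕ → ℝ, (∀ j, 0 ≤ b j) ∧ (∀ m : ℕ, Tendsto (fun j => M j ^ m * b j) atTop (𝓝 0)) ∧
      ∀ j, ∀ k ≤ r, ∀ x, ‖iteratedFDeriv ℝ k (f j) x‖ ≤ b j

theorem norm_iteratedFDeriv_bilinear_le (B : V₁ →L[ℝ] V₂ →L[ℝ] V) {f : X → V₁} {g : X → V₂}
    (hf : ContDiff ℝ ((⊤ : ℕ∞) : WithTop ℕ∞) f) (hg : ContDiff ℝ ((⊤ : ℕ∞) : WithTop ℕ∞) g)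
    {r : ℕ} {a b : ℝ} {x : X} (ha : ∀ k ≤ r, ‖iteratedFDeriv ℝ k f x‖ ≤ a)
    (hb : ∀ k ≤ r, ‖iteratedFDeriv ℝ k g x‖ ≤ b) {k : ℕ} (hk : k ≤ r) :
    ‖iteratedFDeriv ℝ k (fun y => B (f y) (g y)) x‖ ≤ ‖B‖ * 2 ^ r * (a * b) := by
  have ha0 : 0 ≤ a := (norm_nonneg _).trans (ha 0 (Nat.zero_le _))
  have hb0 : 0 ≤ b := (norm_nonneg _).trans (hb 0 (Nat.zero_le _))
  refine (B.norm_iteratedFDeriv_le_of_bilinear hf hg x (n := k)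
    (by exact_mod_cast le_top)).trans ?_
  rw [mul_assoc]
  gcongr
  calc ∑ i ∈ Finset.range (k + 1), (k.choose i : ℝ) * ‖iteratedFDeriv ℝ i f x‖ *
        ‖iteratedFDeriv ℝ (k - i) g x‖
      ≤ ∑ i ∈ Finset.range (k + 1), (k.choose i : ℝ) * (a * b) := by
        refine Finset.sum_le_sum fun i hi => ?_
        rw [mul_assoc]
        have hi' : i ≤ k := Nat.lt_succ_iff.1 (Finset.mem_range.1 hi)
        gcongr
        · exact ha i (hi'.trans hk)
        · exact hb (k - i) ((Nat.sub_le _ _).trans hk)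
    _ = 2 ^ k * (a * b) := by
        rw [← Finset.sum_mul, ← Nat.cast_sum, Nat.sum_range_choose]
        push_cast
        ring
    _ ≤ 2 ^ r * (a * b) := by gcongr; norm_num

variable {M : ℕ → ℝ} {r : ℕ}

theorem Tame.mono {f : ℕ → X → V} (hf : Tame M r f) {s : ℕ} (hs : s ≤ r) : Tame M s f := by
  obtain ⟨h, C, m, hC, hb⟩ := hf
  exact ⟨h, C, m, hC, fun j k hk x => hb j k (hk.trans hs) x⟩

theorem Tame.bilinear (B : V₁ →L[ℝ] V₂ →L[ℝ] V) {f : ℕ → X → V₁}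
    {g : ℕ → X → V₂} (hf : Tame M r f) (hg : Tame M r g) :
    Tame M r fun j x => B (f j x) (g j x) := by
  obtain ⟨hf1, C, m, hC, hf2⟩ := hf
  obtain ⟨hg1, C', m', hC', hg2⟩ := hg
  refine ⟨fun j => (B.contDiff.comp (hf1 j)).clm_apply (hg1 j),
    ‖B‖ * 2 ^ r * (C * C'), m + m', by positivity, fun j k hk x => ?_⟩
  refine (norm_iteratedFDeriv_bilinear_le B (hf1 j) (hg1 j) (fun k hk => hf2 j k hk x)
    (fun k hk => hg2 j k hk x) hk).trans_eq ?_
  ring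

/-- The polynomial loss `M ^ m` from the tame factor is absorbed by using the decay of the other
factor at exponent `p + m`. -/
theorem Negligible.bilinear_left (hM : ∀ j, 1 ≤ M j) (B : V₁ →L[ℝ] V₂ →L[ℝ] V) {f : ℕ → X → V₁}
    {g : ℕ → X → V₂} (hf : Tame M r f) (hg : Negligible M r g) :
    Negligible M r fun j x => B (f j x) (g j x) := by
  obtain ⟨hf1, C, m, hC, hf2⟩ := hf
  obtain ⟨hg1, b, hb, ht, hg2⟩ := hg
  have hM0 : ∀ j, 0 ≤ M j := fun j => zero_le_one.trans (hM j)
  refine ⟨fun j => (B.contDiff.comp (hf1 j)).clm_apply (hg1 j),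
    fun j => ‖B‖ * 2 ^ r * (C * M j ^ m * b j), fun j => ?_, fun p => ?_, fun j k hk x =>
    norm_iteratedFDeriv_bilinear_le B (hf1 j) (hg1 j) (fun k hk => hf2 j k hk x)
    (fun k hk => hg2 j k hk x) hk⟩
  · have := hM0 j
    have := hb j
    positivity
  · have := (ht (p + m)).const_mul (‖B‖ * 2 ^ r * C)
    rw [mul_zero] at this
    refine this.congr fun j => ?_
    ring

theorem Negligible.bilinear_right (hM : ∀ j, 1 ≤ M j) (B : V₁ →L[ℝ] V₂ →L[ℝ] V) {f : ℕ → X → V₁}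
    {g : ℕ → X → V₂} (hf : Negligible M r f) (hg : Tame M r g) :
    Negligible M r fun j x => B (f j x) (g j x) :=
  Negligible.bilinear_left hM B.flip hg hf

theorem Tame.clm (L : V →L[ℝ] V₁) {f : ℕ → X → V} (hf : Tame M r f) :
    Tame M r fun j x => L (f j x) := by
  obtain ⟨hf1, C, m, hC, hf2⟩ := hf
  refine ⟨fun j => L.contDiff.comp (hf1 j), ‖L‖ * C, m, by positivity, fun j k hk x => ?_⟩
  refine (L.norm_iteratedFDeriv_comp_left (hf1 j).contDiffAt
    (by exact_mod_cast le_top)).trans ?_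
  rw [mul_assoc]
  gcongr
  exact hf2 j k hk x

theorem Negligible.clm (L : V →L[ℝ] V₁) {f : ℕ → X → V} (hf : Negligible M r f) :
    Negligible M r fun j x => L (f j x) := by
  obtain ⟨hf1, b, hb, ht, hf2⟩ := hf
  refine ⟨fun j => L.contDiff.comp (hf1 j), fun j => ‖L‖ * b j,
    fun j => mul_nonneg (norm_nonneg _) (hb j), fun m => ?_, fun j k hk x => ?_⟩
  · have := (ht m).const_mul ‖L‖
    rw [mul_zero] at this
    refine this.congr fun j => ?_
    ring
  · refine (L.norm_iteratedFDeriv_comp_left (hf1 j).contDiffAt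
      (by exact_mod_cast le_top)).trans ?_
    exact mul_le_mul_of_nonneg_left (hf2 j k hk x) (norm_nonneg _)

theorem norm_iteratedFDeriv_add_le {f g : X → V} (hf : ContDiff ℝ ((⊤ : ℕ∞) : WithTop ℕ∞) f)
    (hg : ContDiff ℝ ((⊤ : ℕ∞) : WithTop ℕ∞) g) (k : ℕ) (x : X) :
    ‖iteratedFDeriv ℝ k (fun y => f y + g y) x‖ ≤
      ‖iteratedFDeriv ℝ k f x‖ + ‖iteratedFDeriv ℝ k g x‖ := by
  have := iteratedFDeriv_add_apply (𝕜 := ℝ) (i := k) (x := x) (f := f) (g := g)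
    (hf.contDiffAt.of_le (by exact_mod_cast le_top)) (hg.contDiffAt.of_le (by exact_mod_cast le_top))
  change ‖iteratedFDeriv ℝ k (f + g) x‖ ≤ _
  rw [this]
  exact norm_add_le _ _

theorem Tame.add (hM : ∀ j, 1 ≤ M j) {f g : ℕ → X → V} (hf : Tame M r f) (hg : Tame M r g) :
    Tame M r fun j x => f j x + g j x := by
  obtain ⟨hf1, C, m, hC, hf2⟩ := hf
  obtain ⟨hg1, C', m', hC', hg2⟩ := hg
  refine ⟨fun j => (hf1 j).add (hg1 j), C + C', m + m', by positivity, fun j k hk x => ?_⟩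
  refine (norm_iteratedFDeriv_add_le (hf1 j) (hg1 j) k x).trans ?_
  rw [add_mul]
  refine add_le_add ((hf2 j k hk x).trans ?_) ((hg2 j k hk x).trans ?_)
  · gcongr
    · exact hM j
    · exact Nat.le_add_right _ _
  · gcongr
    · exact hM j
    · exact Nat.le_add_left _ _

theorem Negligible.add {f g : ℕ → X → V} (hf : Negligible M r f) (hg : Negligible M r g) :
    Negligible M r fun j x => f j x + g j x := by
  obtain ⟨hf1, b, hb, ht, hf2⟩ := hf
  obtain ⟨hg1, b', hb', ht', hg2⟩ := hg
  refine ⟨fun j => (hf1 j).add (hg1 j), fun j => b j + b' j, fun j => add_nonneg (hb j) (hb' j),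
    fun m => ?_, fun j k hk x => ?_⟩
  · have := (ht m).add (ht' m)
    rw [add_zero] at this
    refine this.congr fun j => ?_
    ring
  · exact (norm_iteratedFDeriv_add_le (hf1 j) (hg1 j) k x).trans
      (add_le_add (hf2 j k hk x) (hg2 j k hk x))

theorem Negligible.sub {f g : ℕ → X → V} (hf : Negligible M r f) (hg : Negligible M r g) :
    Negligible M r fun j x => f j x - g j x := by
  simpa [sub_eq_add_neg] using hf.add (hg.clm (-ContinuousLinearMap.id ℝ V))

theorem Tame.const {c : ℕ → V} {C : ℝ} (hc : ∀ j, ‖c j‖ ≤ C) :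
    Tame M r fun (j : ℕ) (_ : X) => c j := by
  have hC : 0 ≤ C := (norm_nonneg _).trans (hc 0)
  refine ⟨fun j => contDiff_const, C, 0, hC, fun j k _ x => ?_⟩
  rw [pow_zero, mul_one]
  rcases Nat.eq_zero_or_pos k with rfl | hk
  · simpa using hc j
  · rw [iteratedFDeriv_const_of_ne hk.ne']
    simpa using hC

theorem Tame.mul {f g : ℕ → X → R} (hf : Tame M r f) (hg : Tame M r g) :
    Tame M r fun j x => f j x * g j x :=
  Tame.bilinear (ContinuousLinearMap.mul ℝ R) hf hg

theorem Negligible.mul_left (hM : ∀ j, 1 ≤ M j) {f g : ℕ → X → R} (hf : Tame M r f)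
    (hg : Negligible M r g) : Negligible M r fun j x => f j x * g j x :=
  Negligible.bilinear_left hM (ContinuousLinearMap.mul ℝ R) hf hg

theorem Negligible.mul_right (hM : ∀ j, 1 ≤ M j) {f g : ℕ → X → R} (hf : Negligible M r f)
    (hg : Tame M r g) : Negligible M r fun j x => f j x * g j x :=
  Negligible.bilinear_right hM (ContinuousLinearMap.mul ℝ R) hf hg

theorem Tame.sum (hM : ∀ j, 1 ≤ M j) {ι : Type*} (s : Finset ι) {f : ι → ℕ → X → V}
    (hf : ∀ i ∈ s, Tame M r (f i)) : Tame M r fun j x => ∑ i ∈ s, f i j x := by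
  classical
  induction s using Finset.induction_on with
  | empty =>
    simpa using Tame.const (M := M) (r := r) (X := X) (c := fun _ => (0 : V)) (C := 0) (by simp)
  | insert a s ha ih =>
    simp_rw [Finset.sum_insert ha]
    exact (hf a (Finset.mem_insert_self a s)).add hM
      (ih fun i hi => hf i (Finset.mem_insert_of_mem hi))

theorem Tame.prod {ι : Type*} (s : Finset ι) {f : ι → ℕ → X → ℂ}
    (hf : ∀ i ∈ s, Tame M r (f i)) : Tame M r fun j x => ∏ i ∈ s, f i j x := by
  classical
  induction s using Finset.induction_on with
  | empty =>
    simpa using Tame.const (M := M) (r := r) (X := X) (c := fun _ => (1 : ℂ)) (C := 1) (by simp)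
  | insert a s ha ih =>
    simp_rw [Finset.prod_insert ha]
    exact (hf a (Finset.mem_insert_self a s)).mul
      (ih fun i hi => hf i (Finset.mem_insert_of_mem hi))

theorem Tame.fderiv {f : ℕ → X → V} (hf : Tame M (r + 1) f) :
    Tame M r fun j => fderiv ℝ (f j) := by
  obtain ⟨hf1, C, m, hC, hf2⟩ := hf
  refine ⟨fun j => (hf1 j).fderiv_right (by simp), C, m, hC, fun j k hk x => ?_⟩
  rw [norm_iteratedFDeriv_fderiv]
  exact hf2 j (k + 1) (by omega) x

theorem Tame.of_fderiv (hM : ∀ j, 1 ≤ M j) {f : ℕ → X → V} (hf0 : Tame M 0 f)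
    (hf : Tame M r fun j => _root_.fderiv ℝ (f j)) : Tame M (r + 1) f := by
  obtain ⟨hf1, C, m, hC, hf2⟩ := hf0
  obtain ⟨-, C', m', hC', hf2'⟩ := hf
  have hM0 : ∀ j, 0 ≤ M j := fun j => zero_le_one.trans (hM j)
  refine ⟨hf1, C + C', m + m', by positivity, fun j k hk x => ?_⟩
  have hj := hM0 j
  rw [add_mul]
  rcases k with _ | k
  · refine ((hf2 j 0 le_rfl x).trans ?_).trans (le_add_of_nonneg_right (by positivity))
    gcongr
    · exact hM j
    · exact Nat.le_add_right _ _
  · rw [← norm_iteratedFDeriv_fderiv]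
    refine ((hf2' j k (by omega) x).trans ?_).trans (le_add_of_nonneg_left (by positivity))
    gcongr
    · exact hM j
    · exact Nat.le_add_left _ _

theorem contDiff_of_mul_eq_one [CompleteSpace R] {f g : X → R}
    (hf : ContDiff ℝ ((⊤ : ℕ∞) : WithTop ℕ∞) f) (h1 : ∀ x, f x * g x = 1)
    (h2 : ∀ x, g x * f x = 1) : ContDiff ℝ ((⊤ : ℕ∞) : WithTop ℕ∞) g := by
  have hg : g = fun x => Ring.inverse (f x) := by
    funext x
    exact (Ring.inverse_unit (⟨f x, g x, h1 x, h2 x⟩ : Rˣ)).symm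
  rw [hg, contDiff_iff_contDiffAt]
  intro x
  exact (contDiffAt_ringInverse ℝ (⟨f x, g x, h1 x, h2 x⟩ : Rˣ)).comp x hf.contDiffAt

theorem fderiv_of_mul_eq_one [CompleteSpace R] {f g : X → R} (hf : Differentiable ℝ f)
    (h1 : ∀ x, f x * g x = 1) (h2 : ∀ x, g x * f x = 1) (x : X) :
    fderiv ℝ g x =
      (-ContinuousLinearMap.mulLeftRight ℝ R (g x) (g x)) ∘L fderiv ℝ f x := by
  have hg : g = fun x => Ring.inverse (f x) := by
    funext x
    exact (Ring.inverse_unit (⟨f x, g x, h1 x, h2 x⟩ : Rˣ)).symm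
  have h := (hasFDerivAt_ringInverse (𝕜 := ℝ) (⟨f x, g x, h1 x, h2 x⟩ : Rˣ)).comp x
    (hf x).hasFDerivAt
  conv_lhs => rw [hg]
  exact h.fderiv

/-- Since `Dg = -g (Df) g`, order `r + 1` of the inverse is controlled by order `r` of the inverse
and order `r + 1` of `f`. By induction only a sup bound on `g` has to be supplied. -/
theorem Tame.of_mul_eq_one [CompleteSpace R] (hM : ∀ j, 1 ≤ M j) {f g : ℕ → X → R}
    (hf : Tame M r f) (h1 : ∀ j x, f j x * g j x = 1) (h2 : ∀ j x, g j x * f j x = 1)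
    {C : ℝ} {m : ℕ} (hC : 0 ≤ C) (hg : ∀ j x, ‖g j x‖ ≤ C * M j ^ m) : Tame M r g := by
  induction r with
  | zero =>
    refine ⟨fun j => contDiff_of_mul_eq_one (hf.1 j) (h1 j) (h2 j), C, m, hC, fun j k hk x => ?_⟩
    obtain rfl : k = 0 := by omega
    simpa using hg j x
  | succ r ih =>
    have hgr := ih (hf.mono (Nat.le_succ r))
    refine Tame.of_fderiv hM (hgr.mono (Nat.zero_le r)) ?_
    have := (Tame.bilinear (ContinuousLinearMap.compL ℝ X R R)
      (((hgr.bilinear (ContinuousLinearMap.mulLeftRight ℝ R) hgr)).clm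
        (-ContinuousLinearMap.id ℝ (R →L[ℝ] R))) hf.fderiv)
    convert this using 3 with j x
    exact fderiv_of_mul_eq_one ((hf.1 j).differentiable (by simp)) (h1 j) (h2 j) _

end Tame

/-! ### Determinants and adjugates of tame matrix sequences. -/

section MatrixTame

variable {X : Type*} [NormedAddCommGroup X] [NormedSpace ℝ X] {n : ℕ} {M : ℕ → ℝ} {r : ℕ}

theorem tame_matrix_iff (hM : ∀ j, 1 ≤ M j) {f : ℕ → X → Matrix (Fin n) (Fin n) ℂ} :
    Tame M r f ↔ ∀ a b, Tame M r fun j x => f j x a b := by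
  constructor
  · intro hf a b
    exact hf.clm (LinearMap.toContinuousLinearMap
      (Matrix.entryLinearMap ℝ ℂ a b : Matrix (Fin n) (Fin n) ℂ →ₗ[ℝ] ℂ))
  · intro hf
    have : f = fun j x => ∑ a, ∑ b, LinearMap.toContinuousLinearMap
        (Matrix.singleLinearMap ℝ a b : ℂ →ₗ[ℝ] Matrix (Fin n) (Fin n) ℂ) (f j x a b) := by
      funext j x
      exact Matrix.matrix_eq_sum_single (f j x)
    rw [this]
    exact Tame.sum hM _ fun a _ => Tame.sum hM _ fun b _ => (hf a b).clm _

theorem Tame.det (hM : ∀ j, 1 ≤ M j) {f : ℕ → X → Matrix (Fin n) (Fin n) ℂ} (hf : Tame M r f) :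
    Tame M r fun j x => (f j x).det := by
  simp_rw [Matrix.det_apply']
  refine Tame.sum hM _ fun σ _ => ?_
  refine Tame.mul (Tame.const (C := ‖((Equiv.Perm.sign σ : ℤ) : ℂ)‖) fun _ => le_rfl) ?_
  exact Tame.prod _ fun i _ => (tame_matrix_iff hM).1 hf _ _

theorem Tame.adjugate (hM : ∀ j, 1 ≤ M j) {f : ℕ → X → Matrix (Fin n) (Fin n) ℂ}
    (hf : Tame M r f) : Tame M r fun j x => (f j x).adjugate := by
  refine (tame_matrix_iff hM).2 fun a b => ?_
  simp_rw [Matrix.adjugate_apply]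
  refine Tame.det hM ((tame_matrix_iff hM).2 fun p q => ?_)
  simp_rw [Matrix.updateRow_apply]
  split_ifs
  · exact Tame.const (C := ‖(Pi.single a (1 : ℂ) : Fin n → ℂ) q‖) fun _ => le_rfl
  · exact (tame_matrix_iff hM).1 hf p q

end MatrixTame

/-! ### Jacobi's formula and the derivative of the relative determinant. -/

section MatrixDerivative

variable {n : ℕ}

theorem Matrix.hasDerivAt_det {Q : ℝ → Matrix (Fin n) (Fin n) ℂ} {Q' : Matrix (Fin n) (Fin n) ℂ}
    {t : ℝ} (hQ : HasDerivAt Q Q' t) :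
    HasDerivAt (fun s => (Q s).det) ((Q t).adjugate * Q').trace t := by
  let D : ContinuousMultilinearMap ℝ (fun _ : Fin n => Fin n → ℂ) ℂ :=
    { toMultilinearMap := (Matrix.detRowAlternating (n := Fin n) (R :=
        ℂ)).toMultilinearMap.restrictScalars ℝ
      cont := by
        change Continuous fun M : Matrix (Fin n) (Fin n) ℂ => M.det
        exact continuous_id.matrix_det }
  have hrow : HasDerivAt (fun s => (fun i => Q s i : Fin n → Fin n → ℂ)) (fun i => Q' i) t := by
    rw [hasDerivAt_pi]
    intro i
    rw [hasDerivAt_pi]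
    intro k
    exact (LinearMap.toContinuousLinearMap (Matrix.entryLinearMap ℝ ℂ i k :
      Matrix (Fin n) (Fin n) ℂ →ₗ[ℝ] ℂ)).hasFDerivAt.comp_hasDerivAt t hQ
  have h := (D.hasFDerivAt (fun i => Q t i)).comp_hasDerivAt t hrow
  rw [ContinuousMultilinearMap.linearDeriv_apply] at h
  refine h.congr_deriv ?_
  -- Cramer's rule: replacing row `i` of `Q` by row `i` of `Q'` gives a diagonal entry of `Q' adj
  -- Q`.
  have hi : ∀ i, D (Function.update (fun i => Q t i) i (Q' i)) = (Q' * (Q t).adjugate) i i := by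
    intro i
    change ((Q t).updateRow i (Q' i)).det = _
    rw [← Matrix.cramer_transpose_apply, Matrix.cramer_eq_adjugate_mulVec,
      ← Matrix.adjugate_transpose, Matrix.mulVec_transpose]
    rfl
  rw [Matrix.trace_mul_comm]
  exact Finset.sum_congr rfl fun i _ => hi i

/-- With `Q = Y W`, the derivative of `Q` is `[B, Q] + F Q - Y H`. The commutator disappears because
both `tr (adj Q · B Q)` and `tr (adj Q · Q B)` equal `det Q · tr B`; no bound on `B` is therefore
needed. -/
theorem Matrix.hasDerivAt_det_inv_mul {Z Y W : ℝ → Matrix (Fin n) (Fin n) ℂ}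
    {A B F H : Matrix (Fin n) (Fin n) ℂ} {t : ℝ} (hYZ : Y t * Z t = 1)
    (hY : HasDerivAt Y (-(Y t * (A * Z t - Z t * (B + F)) * Y t)) t)
    (hW : HasDerivAt W (A * W t - W t * B - H) t) :
    HasDerivAt (fun s => (Y s * W s).det)
      ((Y t * W t).adjugate * (F * (Y t * W t) - Y t * H)).trace t := by
  refine (Matrix.hasDerivAt_det (hY.mul hW)).congr_deriv ?_
  have hZY : Z t * Y t = 1 := mul_eq_one_comm.1 hYZ
  set Q := Y t * W t with hQ
  have h1 : -(Y t * (A * Z t - Z t * (B + F)) * Y t) * W t + Y t * (A * W t - W t * B - H) =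
      (B * Q - Q * B) + (F * Q - Y t * H) := by
    have : Y t * (A * Z t - Z t * (B + F)) * Y t * W t =
        Y t * A * (Z t * Y t) * W t - (Y t * Z t) * (B + F) * (Y t * W t) := by noncomm_ring
    rw [neg_mul, this, hZY, hYZ, hQ]
    noncomm_ring
  have h2 : (Q.adjugate * (B * Q - Q * B)).trace = 0 := by
    rw [mul_sub, Matrix.trace_sub, ← mul_assoc, Matrix.trace_mul_comm (Q.adjugate * B) Q,
      ← mul_assoc, ← mul_assoc, Matrix.mul_adjugate, Matrix.adjugate_mul, sub_self]
  change (Q.adjugate * (-(Y t * (A * Z t - Z t * (B + F)) * Y t) * W t +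
    Y t * (A * W t - W t * B - H))).trace = _
  rw [h1, mul_add, Matrix.trace_add, h2, zero_add]

end MatrixDerivative

/-! ### Real combinations `Re Z + t Im Z` and a lower bound for the relative determinant. -/

section RealCombination

variable {n : ℕ}

/-- The real matrix `Re Z + t Im Z`, as a function of `Z`. -/
noncomputable def Matrix.reAddImCLM (n : ℕ) (t : ℝ) :
    Matrix (Fin n) (Fin n) ℂ →L[ℝ] Matrix (Fin n) (Fin n) ℝ :=
  LinearMap.toContinuousLinearMap (Complex.reLm.mapMatrix + t • Complex.imLm.mapMatrix)

/-- Complexification of real matrices. -/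
noncomputable def Matrix.ofRealCLM (n : ℕ) : Matrix (Fin n) (Fin n) ℝ →L[ℝ] Matrix (Fin n) (Fin n) ℂ :=
  LinearMap.toContinuousLinearMap (Complex.ofRealAm.toLinearMap.mapMatrix)

theorem Matrix.reAddImCLM_apply (t : ℝ) (Z : Matrix (Fin n) (Fin n) ℂ) :
    Matrix.reAddImCLM n t Z = Z.map Complex.re + t • Z.map Complex.im := rfl

theorem Matrix.ofRealCLM_apply (A : Matrix (Fin n) (Fin n) ℝ) :
    Matrix.ofRealCLM n A = A.map Complex.ofReal := rfl

/-- Isolating `t` as a scalar in front of fixed linear maps makes later estimates uniform in `t ∈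
[-1, 1]`. -/
theorem Matrix.reAddImCLM_eq (t : ℝ) (Z : Matrix (Fin n) (Fin n) ℂ) :
    Matrix.reAddImCLM n t Z = Matrix.reAddImCLM n 0 Z +
      t • (Matrix.reAddImCLM n 1 - Matrix.reAddImCLM n 0) Z := by
  simp [Matrix.reAddImCLM_apply]

theorem Matrix.reAddImCLM_zero_ofRealCLM (A : Matrix (Fin n) (Fin n) ℝ) :
    Matrix.reAddImCLM n 0 (Matrix.ofRealCLM n A) = A := by
  ext i k
  simp [Matrix.reAddImCLM_apply, Matrix.ofRealCLM_apply]

theorem Matrix.reAddImCLM_ofReal_mul (t : ℝ) (A : Matrix (Fin n) (Fin n) ℝ)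
    (Z : Matrix (Fin n) (Fin n) ℂ) :
    Matrix.reAddImCLM n t (A.map Complex.ofReal * Z) = A * Matrix.reAddImCLM n t Z := by
  ext i k
  simp [Matrix.reAddImCLM_apply, Matrix.mul_apply, mul_add, Finset.sum_add_distrib,
    Finset.mul_sum, mul_left_comm t]

theorem Matrix.reAddImCLM_mul_ofReal (t : ℝ) (Z : Matrix (Fin n) (Fin n) ℂ)
    (A : Matrix (Fin n) (Fin n) ℝ) :
    Matrix.reAddImCLM n t (Z * A.map Complex.ofReal) = Matrix.reAddImCLM n t Z * A := by
  ext i k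
  simp [Matrix.reAddImCLM_apply, Matrix.mul_apply, add_mul, Finset.sum_add_distrib,
    Finset.mul_sum, mul_assoc]

theorem Matrix.ofRealCLM_mul (A B : Matrix (Fin n) (Fin n) ℝ) :
    Matrix.ofRealCLM n (A * B) = Matrix.ofRealCLM n A * Matrix.ofRealCLM n B :=
  Complex.ofRealHom.mapMatrix.map_mul A B

theorem Matrix.ofRealCLM_one :
    Matrix.ofRealCLM n (1 : Matrix (Fin n) (Fin n) ℝ) = 1 :=
  (Complex.ofRealHom.mapMatrix (m := Fin n)).map_one

theorem Matrix.det_ofRealCLM (A : Matrix (Fin n) (Fin n) ℝ) :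
    (Matrix.ofRealCLM n A).det = A.det :=
  (Complex.ofRealHom.map_det A).symm

/-- The determinant of `Z⁻¹ (Re Z + t Im Z)`. -/
noncomputable def relDet (t : ℝ) (Z : GL (Fin n) ℂ) : ℂ :=
  (((Z⁻¹ : GL (Fin n) ℂ) : Matrix (Fin n) (Fin n) ℂ) *
    Matrix.ofRealCLM n (Matrix.reAddImCLM n t (Z : Matrix (Fin n) (Fin n) ℂ))).det

/-- Let `t` become complex: `Z⁻¹ (Re Z + z Im Z)` is affine in `z` and equals the identity at `z =
i`. -/
theorem exists_polynomial_relDet (Z : GL (Fin n) ℂ) : ∃ P : Polynomial ℂ,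
    P.natDegree ≤ n ∧ P.eval Complex.I = 1 ∧ ∀ t : ℝ, P.eval (t : ℂ) = relDet t Z := by
  set Y : Matrix (Fin n) (Fin n) ℂ := ((Z⁻¹ : GL (Fin n) ℂ) : Matrix (Fin n) (Fin n) ℂ) with hY
  set X : Matrix (Fin n) (Fin n) ℂ := (Z : Matrix (Fin n) (Fin n) ℂ) with hX
  have hYX : Y * X = 1 := by simp [hY, hX]
  set S := Y * (X.map Complex.im).map Complex.ofReal with hS
  set T := Y * (X.map Complex.re).map Complex.ofReal with hT
  have heval : ∀ z : ℂ, ((Polynomial.X (R := ℂ) • S.map Polynomial.C + T.map Polynomial.C).det).eval z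
      = (Y * ((X.map Complex.re).map Complex.ofReal +
        z • (X.map Complex.im).map Complex.ofReal)).det := by
    intro z
    rw [← Polynomial.coe_evalRingHom, RingHom.map_det]
    congr 1
    rw [mul_add, mul_smul_comm, ← hS, ← hT]
    ext i k
    simp [add_comm, mul_comm z]
  refine ⟨(Polynomial.X (R := ℂ) • S.map Polynomial.C + T.map Polynomial.C).det, ?_, ?_, ?_⟩
  · simpa using Polynomial.natDegree_det_X_add_C_le S T
  · rw [heval]
    have : (X.map Complex.re).map Complex.ofReal +
        Complex.I • (X.map Complex.im).map Complex.ofReal = X := by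
      ext i k
      simp only [Matrix.add_apply, Matrix.map_apply, Matrix.smul_apply, smul_eq_mul]
      rw [mul_comm]
      exact Complex.re_add_im _
    rw [this, hYX, Matrix.det_one]
  · intro t
    rw [heval, relDet]
    congr 2
    ext i k
    simp [Matrix.ofRealCLM_apply, Matrix.reAddImCLM_apply, hX]

/-- Interpolation writes `1 = P(i)` as a combination of the values of `P` at `n + 1` nodes in `[0,
1)`, with coefficients depending on `n` only. These values cannot all be small. -/
theorem exists_le_norm_relDet (n : ℕ) : ∃ c : ℝ, 0 < c ∧ ∀ Z : GL (Fin n) ℂ,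
    ∃ i ∈ Finset.range (n + 1), c ≤ ‖relDet ((i : ℝ) / (n + 1)) Z‖ := by
  let v : ℕ → ℂ := fun i => (((i : ℝ) / (n + 1) : ℝ) : ℂ)
  have hv : Set.InjOn v (Finset.range (n + 1)) := by
    intro i _ k _ h
    have h' : (i : ℝ) / (n + 1) = k / (n + 1) := Complex.ofReal_injective h
    have hn : (n : ℝ) + 1 ≠ 0 := by positivity
    rw [div_left_inj' hn] at h'
    exact_mod_cast h'
  set K := ∑ i ∈ Finset.range (n + 1),
    ‖(Lagrange.basis (Finset.range (n + 1)) v i).eval Complex.I‖ with hK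
  have hK0 : 0 ≤ K := Finset.sum_nonneg fun _ _ => norm_nonneg _
  -- If every value were below `1 / (K + 1)`, the combination would have norm at most `K / (K + 1) <
  -- 1`.
  refine ⟨1 / (K + 1), by positivity, fun Z => ?_⟩
  by_contra! hcon
  obtain ⟨P, hdeg, hI, hP⟩ := exists_polynomial_relDet Z
  have hint := Lagrange.eq_interpolate (f := P) hv (by
    rw [Finset.card_range]
    exact (Polynomial.degree_le_natDegree).trans_lt (by exact_mod_cast Nat.lt_succ_of_le hdeg))
  rw [hint, Lagrange.interpolate_apply, Polynomial.eval_finsetSum] at hI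
  have hle : (1 : ℝ) ≤ 1 / (K + 1) * K := by
    calc (1 : ℝ) = ‖(1 : ℂ)‖ := by simp
      _ ≤ ∑ i ∈ Finset.range (n + 1), 1 / (K + 1) *
          ‖(Lagrange.basis (Finset.range (n + 1)) v i).eval Complex.I‖ := by
        rw [← hI]
        refine norm_sum_le_of_le _ fun i hi => ?_
        rw [Polynomial.eval_mul, Polynomial.eval_C, norm_mul]
        gcongr
        rw [hP]
        exact (hcon i hi).le
      _ = 1 / (K + 1) * K := by rw [← Finset.mul_sum]
  rw [one_div_mul_eq_div, le_div_iff₀ (by positivity)] at hle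
  linarith

end RealCombination

/-! ### From the complex almost reduction to the real one. -/

section AlmostReduction

open Filter Topology

theorem one_add_add_pow_le {a b : ℝ} (ha : 0 ≤ a) (hb : 0 ≤ b) (m : ℕ) :
    (1 + a + b) ^ m ≤ 3 ^ m * (1 + a ^ m + b ^ m) := by
  have key : ∀ c : ℝ, 0 ≤ c → 1 ≤ c → a ≤ c → b ≤ c → c ^ m ≤ 1 + a ^ m + b ^ m →
      (1 + a + b) ^ m ≤ 3 ^ m * (1 + a ^ m + b ^ m) := fun c hc h1 h2 h3 h4 => by
    calc (1 + a + b) ^ m ≤ (3 * c) ^ m := by gcongr; linarith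
      _ = 3 ^ m * c ^ m := mul_pow _ _ _
      _ ≤ _ := by gcongr
  have ham := pow_nonneg ha m
  have hbm := pow_nonneg hb m
  rcases le_total a b with hab | hab
  · rcases le_total b 1 with h | h
    · exact key 1 zero_le_one le_rfl (hab.trans h) h (by simp; linarith)
    · exact key b hb h hab le_rfl (by linarith)
  · rcases le_total a 1 with h | h
    · exact key 1 zero_le_one le_rfl h (hab.trans h) (by simp; linarith)
    · exact key a ha h le_rfl hab (by linarith)

section Lift

variable {d : ℕ} {V : Type*} [NormedAddCommGroup V] [NormedSpace ℝ V]

/-- The periodic lifts of a sequence of maps on the torus. -/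
def torusLift (f : ℕ → UnitAddTorus (Fin d) → V) (j : ℕ) (x : Fin d → ℝ) : V :=
  f j (torusProj x)

theorem Tame.exists_crNorm_le {M : ℕ → ℝ} {r : ℕ} {f : ℕ → UnitAddTorus (Fin d) → V}
    (hf : Tame M r (torusLift f)) : ∃ (C : ℝ) (m : ℕ), 0 ≤ C ∧ ∀ j, crNorm r (f j) ≤ C * M j ^ m :=
  let ⟨_, C, m, hC, h⟩ := hf
  ⟨C, m, hC, fun j => crNorm_le (h j)⟩

theorem Negligible.tendsto_crNorm {M : ℕ → ℝ} {r : ℕ} {f : ℕ → UnitAddTorus (Fin d) → V}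
    (hM : ∀ j, 1 ≤ M j) (hf : Negligible M r (torusLift f)) (m : ℕ) :
    Tendsto (fun j => M j ^ m * crNorm r (f j)) atTop (𝓝 0) := by
  obtain ⟨_, b, _, ht, h⟩ := hf
  have hM0 : ∀ j, 0 ≤ M j := fun j => zero_le_one.trans (hM j)
  refine squeeze_zero (fun j => mul_nonneg (pow_nonneg (hM0 j) m) (crNorm_nonneg _ _))
    (fun j => ?_) (ht m)
  exact mul_le_mul_of_nonneg_left (crNorm_le (h j)) (pow_nonneg (hM0 j) m)

theorem Tame.tendsto_crNorm_pow_mul {V' : Type*} [NormedAddCommGroup V'] [NormedSpace ℝ V']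
    {M : ℕ → ℝ} {r : ℕ} {f : ℕ → UnitAddTorus (Fin d) → V} {g : ℕ → UnitAddTorus (Fin d) → V'}
    (hM : ∀ j, 1 ≤ M j) (hf : Tame M r (torusLift f)) (hg : Negligible M r (torusLift g)) (m : ℕ) :
    Tendsto (fun j => crNorm r (f j) ^ m * crNorm r (g j)) atTop (𝓝 0) := by
  obtain ⟨C, p, hC, h⟩ := hf.exists_crNorm_le
  have ht := (hg.tendsto_crNorm hM (p * m)).const_mul (C ^ m)
  rw [mul_zero] at ht
  refine squeeze_zero (fun j => mul_nonneg (pow_nonneg (crNorm_nonneg _ _) m) (crNorm_nonneg _ _))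
    (fun j => ?_) ht
  rw [← mul_assoc, pow_mul, ← mul_pow]
  exact mul_le_mul_of_nonneg_right (pow_le_pow_left₀ (crNorm_nonneg _ _) (h j) m)
    (crNorm_nonneg _ _)

end Lift

variable {d n : ℕ} {ω : Fin d → ℝ}

theorem Tame.reAddImCLM {X : Type*} [NormedAddCommGroup X] [NormedSpace ℝ X] {M : ℕ → ℝ} {r : ℕ}
    (hM : ∀ j, 1 ≤ M j) {f : ℕ → X → Matrix (Fin n) (Fin n) ℂ} (hf : Tame M r f) {t : ℕ → ℝ}
    (ht : ∀ j, t j ∈ Set.Icc (-1 : ℝ) 1) :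
    Tame M r fun j x => Matrix.reAddImCLM n (t j) (f j x) := by
  have ht' : ∀ j, ‖t j‖ ≤ 1 := fun j => abs_le.2 (ht j)
  simp_rw [fun j => Matrix.reAddImCLM_eq (n := n) (t j)]
  exact (hf.clm _).add hM (Tame.bilinear (ContinuousLinearMap.lsmul ℝ ℝ) (Tame.const ht')
    (hf.clm _))

theorem Negligible.reAddImCLM {X : Type*} [NormedAddCommGroup X] [NormedSpace ℝ X] {M : ℕ → ℝ}
    {r : ℕ} (hM : ∀ j, 1 ≤ M j) {f : ℕ → X → Matrix (Fin n) (Fin n) ℂ} (hf : Negligible M r f)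
    {t : ℕ → ℝ} (ht : ∀ j, t j ∈ Set.Icc (-1 : ℝ) 1) :
    Negligible M r fun j x => Matrix.reAddImCLM n (t j) (f j x) := by
  have ht' : ∀ j, ‖t j‖ ≤ 1 := fun j => abs_le.2 (ht j)
  simp_rw [fun j => Matrix.reAddImCLM_eq (n := n) (t j)]
  exact (hf.clm _).add (Negligible.bilinear_left hM (ContinuousLinearMap.lsmul ℝ ℝ)
    (Tame.const ht') (hf.clm _))

theorem ContinuousLinearMap.exists_nonneg_norm_apply_le {V V' : Type*} [NormedAddCommGroup V]
    [NormedSpace ℝ V] [NormedAddCommGroup V'] [NormedSpace ℝ V'] (L : V →L[ℝ] V') :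
    ∃ K : ℝ, 0 ≤ K ∧ ∀ v, ‖L v‖ ≤ K * ‖v‖ :=
  ⟨‖L‖, norm_nonneg _, L.le_opNorm⟩

theorem completeSpace_matrix_complex : CompleteSpace (Matrix (Fin n) (Fin n) ℂ) :=
  FiniteDimensional.complete ℝ _

theorem completeSpace_matrix_real : CompleteSpace (Matrix (Fin n) (Fin n) ℝ) :=
  FiniteDimensional.complete ℝ _

attribute [local instance] completeSpace_matrix_complex completeSpace_matrix_real

theorem TorusSmooth.coe_inv {Z : UnitAddTorus (Fin d) → GL (Fin n) ℂ}
    (hZ : TorusSmooth fun θ => (Z θ : Matrix (Fin n) (Fin n) ℂ)) :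
    TorusSmooth fun θ => ((Z θ)⁻¹ : GL (Fin n) ℂ).val :=
  contDiff_of_mul_eq_one hZ (fun x => (Z (torusProj x)).mul_inv)
    (fun x => (Z (torusProj x)).inv_mul)

theorem TorusSmooth.omegaDeriv_coe_inv {Z : UnitAddTorus (Fin d) → GL (Fin n) ℂ}
    (hZ : TorusSmooth fun θ => (Z θ : Matrix (Fin n) (Fin n) ℂ)) (v : Fin d → ℝ)
    (θ : UnitAddTorus (Fin d)) :
    _root_.omegaDeriv v (fun η => ((Z η)⁻¹ : GL (Fin n) ℂ).val) θ =
      -(((Z θ)⁻¹ : GL (Fin n) ℂ).val * _root_.omegaDeriv v (fun η => (Z η).val) θ *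
        ((Z θ)⁻¹ : GL (Fin n) ℂ).val) := by
  obtain ⟨x, rfl⟩ := torusProj_surjective θ
  rw [hZ.coe_inv.omegaDeriv_torusProj, hZ.omegaDeriv_torusProj,
    fderiv_of_mul_eq_one (ContDiff.differentiable hZ (by simp))
      (fun x => (Z (torusProj x)).mul_inv) (fun x => (Z (torusProj x)).inv_mul)]
  rfl

theorem TorusSmooth.clm {V V' : Type*} [NormedAddCommGroup V] [NormedSpace ℝ V]
    [NormedAddCommGroup V'] [NormedSpace ℝ V'] (L : V →L[ℝ] V') {f : UnitAddTorus (Fin d) → V}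
    (hf : TorusSmooth f) : TorusSmooth fun θ => L (f θ) :=
  L.contDiff.comp hf

theorem TorusSmooth.omegaDeriv_clm {V V' : Type*} [NormedAddCommGroup V] [NormedSpace ℝ V]
    [NormedAddCommGroup V'] [NormedSpace ℝ V'] (L : V →L[ℝ] V') {f : UnitAddTorus (Fin d) → V}
    (hf : TorusSmooth f) (v : Fin d → ℝ) (θ : UnitAddTorus (Fin d)) :
    _root_.omegaDeriv v (fun η => L (f η)) θ = L (_root_.omegaDeriv v f θ) := by
  obtain ⟨x, rfl⟩ := torusProj_surjective θ
  rw [(hf.clm L).omegaDeriv_torusProj, hf.omegaDeriv_torusProj]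
  exact congrArg (fun T => T v) (L.hasFDerivAt.comp x (hf.hasFDerivAt x)).fderiv

/-- The gauge `1 + ‖Z_j‖_{C^r} + ‖Z_j⁻¹‖_{C^r}`. -/
noncomputable def conjGauge (Z : ℕ → UnitAddTorus (Fin d) → GL (Fin n) ℂ) (r j : ℕ) : ℝ :=
  1 + crNorm r (fun θ => (Z j θ : Matrix (Fin n) (Fin n) ℂ)) +
    crNorm r (fun θ => (((Z j θ)⁻¹ : GL (Fin n) ℂ) : Matrix (Fin n) (Fin n) ℂ))

theorem one_le_conjGauge (Z : ℕ → UnitAddTorus (Fin d) → GL (Fin n) ℂ) (r j : ℕ) :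
    1 ≤ conjGauge Z r j := by
  have h1 := crNorm_nonneg r (fun θ => (Z j θ : Matrix (Fin n) (Fin n) ℂ))
  have h2 := crNorm_nonneg r
    (fun θ => (((Z j θ)⁻¹ : GL (Fin n) ℂ) : Matrix (Fin n) (Fin n) ℂ))
  unfold conjGauge
  linarith

variable {A : UnitAddTorus (Fin d) → Matrix (Fin n) (Fin n) ℝ}
  {Z : ℕ → UnitAddTorus (Fin d) → GL (Fin n) ℂ} {B : ℕ → Matrix (Fin n) (Fin n) ℝ}
  {F : ℕ → UnitAddTorus (Fin d) → Matrix (Fin n) (Fin n) ℂ}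

theorem IsAlmostReduction.tame_conj
    (h : IsAlmostReduction ω (fun θ => (A θ).map Complex.ofReal) Z
      (fun j => (B j).map Complex.ofReal) F) (r : ℕ) :
    Tame (conjGauge Z r) r (torusLift fun j θ => (Z j θ).val) := by
  refine ⟨h.smooth_conj, ((d : ℝ) + 1) ^ r, 1, by positivity, fun j k hk x => ?_⟩
  refine (norm_iteratedFDeriv_le_crNorm (h.smooth_conj j) hk x).trans ?_
  have := crNorm_nonneg r (fun θ => (((Z j θ)⁻¹ : GL (Fin n) ℂ) : Matrix (Fin n) (Fin n) ℂ))
  rw [pow_one]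
  gcongr
  unfold conjGauge
  linarith

theorem IsAlmostReduction.tame_conj_inv
    (h : IsAlmostReduction ω (fun θ => (A θ).map Complex.ofReal) Z
      (fun j => (B j).map Complex.ofReal) F) (r : ℕ) :
    Tame (conjGauge Z r) r (torusLift fun j θ => ((Z j θ)⁻¹ : GL (Fin n) ℂ).val) := by
  refine ⟨fun j => (h.smooth_conj j).coe_inv, ((d : ℝ) + 1) ^ r, 1, by positivity,
    fun j k hk x => ?_⟩
  refine (norm_iteratedFDeriv_le_crNorm (h.smooth_conj j).coe_inv hk x).trans ?_
  have := crNorm_nonneg r (fun θ => (Z j θ : Matrix (Fin n) (Fin n) ℂ))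
  rw [pow_one]
  gcongr
  unfold conjGauge
  linarith

theorem IsAlmostReduction.negligible_rem
    (h : IsAlmostReduction ω (fun θ => (A θ).map Complex.ofReal) Z
      (fun j => (B j).map Complex.ofReal) F) (r : ℕ) :
    Negligible (conjGauge Z r) r (torusLift F) := by
  refine ⟨h.smooth_rem, fun j => ((d : ℝ) + 1) ^ r * crNorm r (F j),
    fun j => mul_nonneg (by positivity) (crNorm_nonneg _ _), fun m => ?_,
    fun j k hk x => norm_iteratedFDeriv_le_crNorm (h.smooth_rem j) hk x⟩
  -- The exponent `0` accounts for the summand `1` of the gauge; the other two limits account for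
  -- `Z` and `Z⁻¹`.
  have ht := (((h.tendsto_pos r 0).add (h.tendsto_pos r m)).add (h.tendsto_neg r m)).const_mul
    (((d : ℝ) + 1) ^ r * 3 ^ m)
  simp only [pow_zero, one_mul, add_zero, mul_zero] at ht
  refine squeeze_zero (fun j => ?_) (fun j => ?_) ht
  · have := one_le_conjGauge Z r j
    have := crNorm_nonneg r (F j)
    positivity
  · have h1 := one_add_add_pow_le (crNorm_nonneg r (fun θ => (Z j θ).val))
      (crNorm_nonneg r (fun θ => ((Z j θ)⁻¹ : GL (Fin n) ℂ).val)) m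
    have h2 := crNorm_nonneg r (F j)
    have h3 : (0 : ℝ) ≤ ((d : ℝ) + 1) ^ r * crNorm r (F j) := by positivity
    refine (mul_le_mul_of_nonneg_right h1 h3).trans_eq ?_
    ring

theorem IsAlmostReduction.shift
    (h : IsAlmostReduction ω (fun θ => (A θ).map Complex.ofReal) Z
      (fun j => (B j).map Complex.ofReal) F) (J : ℕ) :
    IsAlmostReduction ω (fun θ => (A θ).map Complex.ofReal) (fun j => Z (J + j))
      (fun j => (B (J + j)).map Complex.ofReal) (fun j => F (J + j)) := by
  have hJ : Tendsto (fun j => J + j) atTop atTop := tendsto_atTop_mono (fun j => Nat.le_add_left j J)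
    tendsto_id
  exact ⟨fun j => h.smooth_conj _, fun j => h.smooth_rem _, fun j => h.conj_eq _,
    fun r m => (h.tendsto_pos r m).comp hJ, fun r m => (h.tendsto_neg r m).comp hJ⟩

/-- `Re + t Im` is real linear and commutes with multiplication by the real matrices `A` and `B`.
Here the reality of `B` is decisive. -/
theorem IsAlmostReduction.omegaDeriv_reAddImCLM
    (h : IsAlmostReduction ω (fun θ => (A θ).map Complex.ofReal) Z
      (fun j => (B j).map Complex.ofReal) F) (t : ℝ) (j : ℕ) (θ : UnitAddTorus (Fin d)) :
    omegaDeriv ω (fun η => Matrix.reAddImCLM n t (Z j η).val) θ =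
      A θ * Matrix.reAddImCLM n t (Z j θ).val - Matrix.reAddImCLM n t (Z j θ).val * B j -
        Matrix.reAddImCLM n t ((Z j θ).val * F j θ) := by
  have he : Matrix.reAddImCLM n t ((A θ).map Complex.ofReal * (Z j θ).val -
      (Z j θ).val * ((B j).map Complex.ofReal + F j θ)) =
      A θ * Matrix.reAddImCLM n t (Z j θ).val - Matrix.reAddImCLM n t (Z j θ).val * B j -
        Matrix.reAddImCLM n t ((Z j θ).val * F j θ) := by
    rw [mul_add, map_sub, map_add, Matrix.reAddImCLM_ofReal_mul, Matrix.reAddImCLM_mul_ofReal,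
      sub_sub]
  exact ((h.smooth_conj j).omegaDeriv_clm (Matrix.reAddImCLM n t) ω θ).trans
    ((congrArg (Matrix.reAddImCLM n t) (h.conj_eq j θ)).trans he)

/-- The matrix `Z⁻¹ (Re Z + t Im Z)`. -/
noncomputable def relMatrix (t : ℝ) (Z : GL (Fin n) ℂ) : Matrix (Fin n) (Fin n) ℂ :=
  (Z⁻¹ : GL (Fin n) ℂ).val * Matrix.ofRealCLM n (Matrix.reAddImCLM n t Z.val)

theorem IsAlmostReduction.omegaDeriv_relDet
    (h : IsAlmostReduction ω (fun θ => (A θ).map Complex.ofReal) Z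
      (fun j => (B j).map Complex.ofReal) F) (t : ℝ) (j : ℕ) (θ : UnitAddTorus (Fin d)) :
    omegaDeriv ω (fun η => relDet t (Z j η)) θ =
      ((relMatrix t (Z j θ)).adjugate * (F j θ * relMatrix t (Z j θ) -
        ((Z j θ)⁻¹ : GL (Fin n) ℂ).val *
          Matrix.ofRealCLM n (Matrix.reAddImCLM n t ((Z j θ).val * F j θ)))).trace := by
  have hθ : θ + torusProj ((0 : ℝ) • ω) = θ := by rw [zero_smul, torusProj_zero, add_zero]
  have hY := (h.smooth_conj j).coe_inv.hasDerivAt_line_omegaDeriv ω θ 0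
  have hW := (((h.smooth_conj j).clm (Matrix.reAddImCLM n t)).clm
    (Matrix.ofRealCLM n)).hasDerivAt_line_omegaDeriv ω θ 0
  rw [(h.smooth_conj j).omegaDeriv_coe_inv, h.conj_eq, hθ] at hY
  have hd : omegaDeriv ω (fun η => Matrix.ofRealCLM n (Matrix.reAddImCLM n t (Z j η).val)) θ =
      (A θ).map Complex.ofReal * Matrix.ofRealCLM n (Matrix.reAddImCLM n t (Z j θ).val) -
        Matrix.ofRealCLM n (Matrix.reAddImCLM n t (Z j θ).val) * (B j).map Complex.ofReal -
          Matrix.ofRealCLM n (Matrix.reAddImCLM n t ((Z j θ).val * F j θ)) := by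
    refine (((h.smooth_conj j).clm (Matrix.reAddImCLM n t)).omegaDeriv_clm
      (Matrix.ofRealCLM n) ω θ).trans
      ((congrArg (Matrix.ofRealCLM n) (h.omegaDeriv_reAddImCLM t j θ)).trans ?_)
    rw [map_sub, map_sub, Matrix.ofRealCLM_mul, Matrix.ofRealCLM_mul]
    rfl
  have := Matrix.hasDerivAt_det_inv_mul (t := 0)
    (Z := fun s => (Z j (θ + torusProj (s • ω))).val)
    (Y := fun s => ((Z j (θ + torusProj (s • ω)))⁻¹ : GL (Fin n) ℂ).val)
    (W := fun s => Matrix.ofRealCLM n (Matrix.reAddImCLM n t (Z j (θ + torusProj (s • ω))).val))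
    (A := (A θ).map Complex.ofReal) (B := (B j).map Complex.ofReal) (F := F j θ)
    (H := Matrix.ofRealCLM n (Matrix.reAddImCLM n t ((Z j θ).val * F j θ)))
    (Units.inv_mul _) (by rw [hθ]; exact hY) (by rw [hθ] at hW ⊢; exact hW.congr_deriv hd)
  rw [hθ] at this
  exact this.deriv

theorem IsAlmostReduction.tame_relMatrix
    (h : IsAlmostReduction ω (fun θ => (A θ).map Complex.ofReal) Z
      (fun j => (B j).map Complex.ofReal) F) {t : ℕ → ℝ} (ht : ∀ j, t j ∈ Set.Icc (-1 : ℝ) 1)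
    (r : ℕ) : Tame (conjGauge Z r) r (torusLift fun j θ => relMatrix (t j) (Z j θ)) :=
  (h.tame_conj_inv r).mul
    (((h.tame_conj r).reAddImCLM (one_le_conjGauge Z r) ht).clm (Matrix.ofRealCLM n))

/-- Every term of the derivative contains `F` once, multiplied by tame factors. -/
theorem IsAlmostReduction.negligible_omegaDeriv_relDet
    (h : IsAlmostReduction ω (fun θ => (A θ).map Complex.ofReal) Z
      (fun j => (B j).map Complex.ofReal) F) {t : ℕ → ℝ} (ht : ∀ j, t j ∈ Set.Icc (-1 : ℝ) 1)
    (r : ℕ) : Negligible (conjGauge Z r) r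
      (torusLift fun j => omegaDeriv ω fun η => relDet (t j) (Z j η)) := by
  have hM := one_le_conjGauge Z r
  have hQ := h.tame_relMatrix ht r
  have hF := h.negligible_rem r
  have := (Negligible.mul_left hM (hQ.adjugate hM) ((hF.mul_right hM hQ).sub
    (Negligible.mul_left hM (h.tame_conj_inv r)
      (((Negligible.mul_left hM (h.tame_conj r) hF).reAddImCLM hM ht).clm
        (Matrix.ofRealCLM n))))).clm
    (LinearMap.toContinuousLinearMap (Matrix.traceLinearMap (Fin n) ℝ ℂ))
  convert this using 3 with j x
  exact h.omegaDeriv_relDet (t j) j (torusProj x)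

theorem IsAlmostReduction.tendsto_relDet_sub {κ τ : ℝ} (hω : IsDiophantine κ τ ω)
    (h : IsAlmostReduction ω (fun θ => (A θ).map Complex.ofReal) Z
      (fun j => (B j).map Complex.ofReal) F) {t : ℝ} (ht : t ∈ Set.Icc (-1 : ℝ) 1) {ε : ℝ}
    (hε : 0 < ε) : ∀ᶠ j in atTop, ∀ θ φ, ‖relDet t (Z j θ) - relDet t (Z j φ)‖ ≤ ε := by
  obtain ⟨r, C, hC⟩ := hω.exists_norm_sub_le
  have hM := one_le_conjGauge Z r
  have hlim := ((h.negligible_omegaDeriv_relDet (t := fun _ => t) (fun _ => ht)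
    r).tendsto_crNorm hM 0).const_mul C
  simp only [pow_zero, one_mul, mul_zero] at hlim
  filter_upwards [hlim.eventually_le_const hε] with j hj θ φ
  exact (hC (fun θ => relDet t (Z j θ)) (((h.tame_relMatrix (t := fun _ => t) (fun _ => ht) r).det hM).1 j) θ φ).trans hj

theorem IsAlmostReduction.exists_le_norm_relDet {κ τ : ℝ} (hω : IsDiophantine κ τ ω)
    (h : IsAlmostReduction ω (fun θ => (A θ).map Complex.ofReal) Z
      (fun j => (B j).map Complex.ofReal) F) :
    ∃ c : ℝ, 0 < c ∧ ∃ J : ℕ, ∀ j, J ≤ j →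
      ∃ t ∈ Set.Icc (-1 : ℝ) 1, ∀ θ, c ≤ ‖relDet t (Z j θ)‖ := by
  obtain ⟨c, hc, hn⟩ := _root_.exists_le_norm_relDet n
  have ht : ∀ i ∈ Finset.range (n + 1), (i : ℝ) / (n + 1) ∈ Set.Icc (-1 : ℝ) 1 := by
    intro i hi
    have hi' : (i : ℝ) ≤ n + 1 := by exact_mod_cast (Finset.mem_range.1 hi).le
    exact ⟨by linarith [show (0 : ℝ) ≤ (i : ℝ) / (n + 1) by positivity],
      div_le_one_of_le₀ hi' (by positivity)⟩
  -- Finitely many nodes, fixed independently of `j`, allow one threshold `J` for all of them.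
  have hev := (Finset.eventually_all (Finset.range (n + 1))).2 fun i hi =>
    h.tendsto_relDet_sub hω (ht i hi) (half_pos hc)
  obtain ⟨J, hJ⟩ := eventually_atTop.1 hev
  refine ⟨c / 2, half_pos hc, J, fun j hj => ?_⟩
  -- The node is chosen at `θ = 0`; an oscillation of at most `c / 2` leaves the bound `c / 2`
  -- everywhere.
  obtain ⟨i, hi, hci⟩ := hn (Z j 0)
  refine ⟨(i : ℝ) / (n + 1), ht i hi, fun θ => ?_⟩
  have h1 := hJ j hj i hi 0 θ
  have h2 := norm_sub_norm_le (relDet ((i : ℝ) / (n + 1)) (Z j 0))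
    (relDet ((i : ℝ) / (n + 1)) (Z j θ))
  linarith

theorem det_reAddImCLM_ne_zero {t : ℝ} {Z : GL (Fin n) ℂ} (h : relDet t Z ≠ 0) :
    (Matrix.reAddImCLM n t Z.val).det ≠ 0 := by
  intro h0
  refine h ?_
  rw [relDet, Matrix.det_mul, Matrix.det_ofRealCLM, h0]
  simp

/-- As `Z⁻¹ = Q V`, multiplying by `adj Q` expresses the inverse `V` by tame quantities, up to
division by `det Q`. -/
theorem relDet_smul_ofRealCLM_inv {t : ℝ} {Z : GL (Fin n) ℂ} {V : Matrix (Fin n) (Fin n) ℝ}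
    (hV : Matrix.reAddImCLM n t Z.val * V = 1) :
    relDet t Z • Matrix.ofRealCLM n V = (relMatrix t Z).adjugate * (Z⁻¹ : GL (Fin n) ℂ).val := by
  have h1 : (Z⁻¹ : GL (Fin n) ℂ).val = relMatrix t Z * Matrix.ofRealCLM n V := by
    rw [relMatrix, mul_assoc, ← Matrix.ofRealCLM_mul, hV, Matrix.ofRealCLM_one, mul_one]
  rw [h1, ← mul_assoc, Matrix.adjugate_mul, smul_mul_assoc, one_mul]
  rfl

theorem IsAlmostReduction.exists_real
    (h : IsAlmostReduction ω (fun θ => (A θ).map Complex.ofReal) Z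
      (fun j => (B j).map Complex.ofReal) F) {t : ℕ → ℝ} (ht : ∀ j, t j ∈ Set.Icc (-1 : ℝ) 1)
    {c : ℝ} (hc : 0 < c) (hq : ∀ j θ, c ≤ ‖relDet (t j) (Z j θ)‖) :
    ∃ (W : ℕ → UnitAddTorus (Fin d) → GL (Fin n) ℝ)
      (G : ℕ → UnitAddTorus (Fin d) → Matrix (Fin n) (Fin n) ℝ),
      (∀ j θ, (W j θ).val = Matrix.reAddImCLM n (t j) (Z j θ).val) ∧
      IsAlmostReduction ω A W B G := by
  have hq0 : ∀ j θ, relDet (t j) (Z j θ) ≠ 0 := fun j θ =>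
    norm_pos_iff.1 (hc.trans_le (hq j θ))
  let W : ℕ → UnitAddTorus (Fin d) → GL (Fin n) ℝ := fun j θ =>
    Matrix.GeneralLinearGroup.mkOfDetNeZero _ (det_reAddImCLM_ne_zero (hq0 j θ))
  have hWval : ∀ j θ, (W j θ).val = Matrix.reAddImCLM n (t j) (Z j θ).val := fun _ _ => rfl
  let H : ℕ → UnitAddTorus (Fin d) → Matrix (Fin n) (Fin n) ℝ := fun j θ =>
    Matrix.reAddImCLM n (t j) ((Z j θ).val * F j θ)
  have hM := one_le_conjGauge Z
  have hW : ∀ r, Tame (conjGauge Z r) r (torusLift fun j θ => (W j θ).val) := fun r =>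
    (h.tame_conj r).reAddImCLM (hM r) ht
  have hH : ∀ r, Negligible (conjGauge Z r) r (torusLift H) := fun r =>
    (Negligible.mul_left (hM r) (h.tame_conj r) (h.negligible_rem r)).reAddImCLM (hM r) ht
  obtain ⟨K, hK0, hK⟩ :=
    ContinuousLinearMap.exists_nonneg_norm_apply_le (Matrix.reAddImCLM n 0)
  have hV : ∀ r, Tame (conjGauge Z r) r (torusLift fun j θ => ((W j θ)⁻¹ : GL (Fin n) ℝ).val) := by
    intro r
    obtain ⟨-, C, m, hC, hb⟩ :=
      ((h.tame_relMatrix ht r).adjugate (hM r)).mul (h.tame_conj_inv r)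
    refine (hW r).of_mul_eq_one (hM r) (fun j x => (W j (torusProj x)).mul_inv)
      (fun j x => (W j (torusProj x)).inv_mul) (C := K * (c⁻¹ * C)) (m := m)
      (by positivity) fun j x => ?_
    have hbx := hb j 0 (Nat.zero_le r) x
    rw [norm_iteratedFDeriv_zero] at hbx
    have hs := relDet_smul_ofRealCLM_inv (t := t j) (Z := Z j (torusProj x))
      (W j (torusProj x)).mul_inv
    have hs' : c * ‖Matrix.ofRealCLM n ((W j (torusProj x))⁻¹ : GL (Fin n) ℝ).val‖ ≤
        C * conjGauge Z r j ^ m := by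
      refine le_trans ?_ hbx
      change _ ≤ ‖(relMatrix (t j) (Z j (torusProj x))).adjugate *
        ((Z j (torusProj x))⁻¹ : GL (Fin n) ℂ).val‖
      rw [← hs, norm_smul]
      gcongr
      exact hq j _
    change ‖((W j (torusProj x))⁻¹ : GL (Fin n) ℝ).val‖ ≤ _
    -- The real inverse is the real part of its complexification, so the complex bound transfers at
    -- the cost of the factor `K`.
    rw [← Matrix.reAddImCLM_zero_ofRealCLM ((W j (torusProj x))⁻¹ : GL (Fin n) ℝ).val]
    refine (hK _).trans ?_
    rw [mul_assoc, mul_assoc]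
    gcongr
    rw [← div_eq_inv_mul, le_div_iff₀ hc, mul_comm]
    exact hs'
  have hG : ∀ r, Negligible (conjGauge Z r) r
      (torusLift fun j θ => ((W j θ)⁻¹ : GL (Fin n) ℝ).val * H j θ) := fun r =>
    Negligible.mul_left (hM r) (hV r) (hH r)
  refine ⟨W, fun j θ => ((W j θ)⁻¹ : GL (Fin n) ℝ).val * H j θ, hWval, (hW 0).1, (hG 0).1,
    fun j θ => ?_, fun r m => (hW r).tendsto_crNorm_pow_mul (hM r) (hG r) m,
    fun r m => (hV r).tendsto_crNorm_pow_mul (hM r) (hG r) m⟩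
  -- The choice `G = W⁻¹ H` gives `W (B + G) = W B + H`, with `B` unchanged.
  rw [mul_add, ← mul_assoc, Units.mul_inv, one_mul, ← sub_sub]
  exact h.omegaDeriv_reAddImCLM (t j) j θ

end AlmostReduction

theorem mainTheorem3 {d n : ℕ} {κ τ : ℝ} {ω : Fin d → ℝ} (hω : IsDiophantine κ τ ω)
    (A : UnitAddTorus (Fin d) → Matrix (Fin n) (Fin n) ℝ) (hA : TorusSmooth A)
    (Z : ℕ → UnitAddTorus (Fin d) → GL (Fin n) ℂ)
    (B : ℕ → Matrix (Fin n) (Fin n) ℝ)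
    (F : ℕ → UnitAddTorus (Fin d) → Matrix (Fin n) (Fin n) ℂ)
    (h : IsAlmostReduction ω (fun θ => (A θ).map Complex.ofReal) Z
      (fun j => (B j).map Complex.ofReal) F) :
    RealAlmostReducible ω A ∧
    ∃ (J : ℕ) (lam : ℕ → ℝ) (W : ℕ → UnitAddTorus (Fin d) → GL (Fin n) ℝ)
      (B' : ℕ → Matrix (Fin n) (Fin n) ℝ)
      (G : ℕ → UnitAddTorus (Fin d) → Matrix (Fin n) (Fin n) ℝ),
      (∀ j, lam j ∈ Set.Icc (-1 : ℝ) 1) ∧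
      (∀ j θ, (W j θ : Matrix (Fin n) (Fin n) ℝ) =
        (Z (J + j) θ : Matrix (Fin n) (Fin n) ℂ).map Complex.re +
          lam j • (Z (J + j) θ : Matrix (Fin n) (Fin n) ℂ).map Complex.im) ∧
      IsAlmostReduction ω A W B' G := by
  obtain ⟨c, hc, J, hJ⟩ := h.exists_le_norm_relDet hω
  choose lam hlam hq using fun j => hJ (J + j) (Nat.le_add_right J j)
  obtain ⟨W, G, hW, hred⟩ := (h.shift J).exists_real hlam hc hq
  exact ⟨⟨W, _, G, hred⟩, J, lam, W, _, G, hlam, hW, hred⟩
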